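/- Theorem (convergence of ASBCDS). Setting. Vectors $\eta\in\mathbb{R}^{mn}$ consist of $m$ blocks $\eta^{[1]},\dots,\eta^{[m]}\in\mathbb{R}^n$. Let $\varphi:\mathbb{R}^{mn}\to\mathbb{R}$ be convex and $L$-smooth ($L>0$; differentiable with $L$-Lipschitz gradient), with a minimizer $\eta^*$. Let $\varphi(\eta)=\mathbb{E}_\xi\,\phi(\eta,\xi)$, where $\phi(\cdot,\xi)$ is almost surely differentiable and $\mathbb{E}_\xi\nabla\phi(\eta,\xi)=\nabla\varphi(\eta)$ for every $\eta$. Algorithm. Put $\theta_1=1/m$, $\theta_{k+1}=\frac12\big(\sqrt{\theta_k^4+4\theta_k^2}-\theta_k^2\big)$ and $d_k=\theta_{k+1}(1-\theta_k)/\theta_k$ for $k\ge1$. Start from a deterministic point $\eta_0=\zeta_0=\lambda_0$, and let $\gamma>0$ be the step size. For $k=0,1,2,\dots$: 1. $\lambda_{k+1}=\theta_{k+1}\zeta_k+(1-\theta_{k+1})\eta_k$. 2. For every block $p$ a stale index $j_p=j_p(k+1)$ with $k-\tau\le j_p\le k$, $j_p\ge0$, is given; it may be random, but depends only on the past of iteration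 $k$. Put $$\omega_{j(k+1)}^{[p]}=\eta_{j_p}^{[p]}+\sum_{i=j_p}^{k}\Big(\prod_{l=j_p}^{i}d_l\Big)\big(\lambda_{j_p}^{[p]}-\eta_{j_p-1}^{[p]}\big),$$ the sum being read as $0$ if $j_p=0$. 3. Draw a block $i_k$ uniformly from $\{1,\dots,m\}$ and $M_{k+1}\ge1$ samples of $\xi$, all independent of each other and of the past. Let $\hat g_{k+1}$ be the average of $\nabla\phi(\omega_{j(k+1)},\cdot)$ over these samples ($M_{k+1}=1$ is the plain algorithm). Put $\zeta_{k+1}^{[i_k]}=\zeta_k^{[i_k]}-\frac{\gamma}{m\theta_{k+1}}\hat g_{k+1}^{[i_k]}$, and $\zeta_{k+1}^{[p]}=\zeta_k^{[p]}$ for $p\neq i_k$. 4. $\eta_{k+1}=\lambda_{k+1}+m\theta_{k+1}(\zeta_{k+1}-\zeta_k)$. Iteration $k$ uses $M_{k+1}$ calls of the stochastic partial-gradient oracle, which returns a single block of $\nabla\phi(\omega,\xi)$ for one sample $\xi$. Claim. For every $c>0$ there is a constant $C>0$, depending only on $c$, such that the following holds for all integers $1\le\tau\le m$, all $L,\gamma,\varepsilon>0$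 with $$c\ \le\ 3L\gamma+12L\gamma\Big(\frac{\tau^2+\tau}{m}+2\tau\Big)^2\ \le\ 1 ,$$ and all $n$, $\varphi$, $\phi$, $\eta_0$, $\eta^*$ as above. (i) If $K$ satisfies $K\ge C\,\frac{m\tau\sqrt{L}\,\|\eta_0-\eta^*\|}{\sqrt{\varepsilon}}$ and $\mathbb{E}\,\|\nabla\varphi(\omega_{j(k)})-\hat g_k\|^2\le \frac{mL\theta_k\varepsilon}{8}$ for all $1\le k\le K$, then $\varphi(\eta_K)$ is integrable and $\mathbb{E}\,\varphi(\eta_K)-\varphi(\eta^*)\le\varepsilon$. (ii) For all $\sigma,R\ge0$ there are $K$ and non-decreasing batch sizes $M_k\ge1$, which depend only on $c,m,\tau,L,\gamma,\varepsilon,\sigma,R$, such that $$K\le C\,\frac{m\tau\sqrt{L}\,R}{\sqrt{\varepsilon}},\qquad \sum_{k=1}^{K}M_k\ \le\ C\Big(\frac{m\tau\sqrt{L}\,R}{\sqrt{\varepsilon}}+\frac{m\tau^2\sigma^2R^2}{\varepsilon^2}\Big),$$ and, whenever $\|\eta_0-\eta^*\|\le R$ and $\mathbb{E}_\xi\|\nabla\varphi(\eta)-\nabla\phi(\eta,\xi)\|^2\le\sigma^2$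 for all $\eta$, the algorithm with these batch sizes yields an integrable $\varphi(\eta_K)$ with $\mathbb{E}\,\varphi(\eta_K)-\varphi(\eta^*)\le\varepsilon$. -/

import Mathlib

open MeasureTheory ProbabilityTheory
open scoped ENNReal

universe u v

noncomputable section

/-- Vectors of `ℝ^{mn}`, split into `m` blocks of length `n`, with the Euclidean norm;
`x p` is the `p`-th block of `x`. -/
abbrev BlockVec (m n : ℕ) : Type :=
  PiLp 2 (fun _ : Fin m => EuclideanSpace ℝ (Fin n))

/-- `φ` is differentiable and its gradient is `L`-Lipschitz. -/
def IsSmoothFun {m n : ℕ} (L : ℝ) (φ : BlockVec m n → ℝ) : Prop :=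
  Differentiable ℝ φ ∧ ∀ x y, ‖gradient φ x - gradient φ y‖ ≤ L * ‖x - y‖

/-- The stochastic gradient `∇φ(x, ξ)`, i.e. the gradient in `x` of the random function
`Φ(x, ξ)`. -/
def stochGrad {m n : ℕ} {Ξ : Type v} (Φ : BlockVec m n → Ξ → ℝ)
    (x : BlockVec m n) (s : Ξ) : BlockVec m n :=
  gradient (fun y => Φ y s) x

/-- `φ(x) = 𝔼_ξ Φ(x, ξ)` for `ξ` of law `D`, and `∇φ(x, ξ)` is an unbiased estimator of
`∇φ(x)`. -/
structure IsStochasticModel {m n : ℕ} {Ξ : Type v} [MeasurableSpace Ξ]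
    (φ : BlockVec m n → ℝ) (Φ : BlockVec m n → Ξ → ℝ) (D : Measure Ξ) : Prop where
  differentiable : ∀ᵐ s ∂D, Differentiable ℝ (fun x => Φ x s)
  integrable : ∀ x, Integrable (fun s => Φ x s) D
  mean : ∀ x, ∫ s, Φ x s ∂D = φ x
  measurable_grad : Measurable (fun q : BlockVec m n × Ξ => stochGrad Φ q.1 q.2)
  integrable_grad : ∀ x, Integrable (fun s => stochGrad Φ x s) D
  mean_grad : ∀ x, ∫ s, stochGrad Φ x s ∂D = gradient φ x

/-- Mini-batch stochastic gradient: the average of `∇φ(x, s_r)` over the samples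
`s_0, …, s_{N-1}`. -/
def batchGrad {m n : ℕ} {Ξ : Type v} (Φ : BlockVec m n → Ξ → ℝ) (N : ℕ) (s : ℕ → Ξ)
    (x : BlockVec m n) : BlockVec m n :=
  (N : ℝ)⁻¹ • ∑ r ∈ Finset.range N, stochGrad Φ x (s r)

/-- `θ₁ = 1/m`, `θ_{k+1} = (√(θ_k⁴ + 4 θ_k²) - θ_k²) / 2` for `k ≥ 1`.
The algorithm does not use a `θ₀`; the convention `θ₀ = 1` gives `d₀ = 0` below. -/
def theta (m : ℕ) : ℕ → ℝ
  | 0 => 1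
  | 1 => 1 / (m : ℝ)
  | (k + 2) =>
      (Real.sqrt (theta m (k + 1) ^ 4 + 4 * theta m (k + 1) ^ 2) - theta m (k + 1) ^ 2) / 2

/-- `d_k = θ_{k+1} (1 - θ_k) / θ_k`. -/
def dCoef (m k : ℕ) : ℝ := theta m (k + 1) * (1 - theta m k) / theta m k

/-- `ρ_i = ∏_{l = j}^{i} d_l`. -/
def rho (m j i : ℕ) : ℝ := ∏ l ∈ Finset.Icc j i, dCoef m l

/-- The first `K` iterations (`k = 0, …, K - 1`) of ASBCDS along one realization.
`J (k+1) p` is the index `j_p(k+1)` of the stale iterate that is used for block `p`, `i k` is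
the block chosen in iteration `k`, and `G (k+1)` is the estimator of the gradient used there.
`w (k+1)` is the compensated point `ω_{j(k+1)}`.
For a stale index `0` there is no earlier iterate and the compensation is zero: `J - 1` is then
`0` and `lam 0 = eta 0`. -/
structure IsASBCDS {m n : ℕ} (γ : ℝ) (K : ℕ) (J : ℕ → Fin m → ℕ) (i : ℕ → Fin m)
    (G : ℕ → BlockVec m n → BlockVec m n) (x₀ : BlockVec m n)
    (lam zeta eta w : ℕ → BlockVec m n) : Prop where
  eta_zero : eta 0 = x₀
  zeta_zero : zeta 0 = x₀
  lam_zero : lam 0 = x₀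
  lam_succ : ∀ k < K,
    lam (k + 1) = theta m (k + 1) • zeta k + (1 - theta m (k + 1)) • eta k
  w_succ : ∀ k < K, ∀ p,
    w (k + 1) p = eta (J (k + 1) p) p
      + ∑ l ∈ Finset.Icc (J (k + 1) p) k,
          rho m (J (k + 1) p) l • (lam (J (k + 1) p) p - eta (J (k + 1) p - 1) p)
  zeta_succ_self : ∀ k < K,
    zeta (k + 1) (i k) = zeta k (i k) - (γ / (m * theta m (k + 1))) • G (k + 1) (w (k + 1)) (i k)
  zeta_succ_other : ∀ k < K, ∀ p, p ≠ i k → zeta (k + 1) p = zeta k p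
  eta_succ : ∀ k < K,
    eta (k + 1) = lam (k + 1) + (m * theta m (k + 1)) • (zeta (k + 1) - zeta k)

/-- The randomness of the first `K` iterations, relative to a history `ℱ`.
In iteration `k` the stale indices depend on the past only and lag at most `τ` behind `k`;
then a uniformly random block `i k` and `M (k+1)` samples of law `D` are drawn, independently
of each other and of the past. -/
structure IsAsyncSampling {Ω : Type u} {Ξ : Type v} [mΩ : MeasurableSpace Ω]
    [MeasurableSpace Ξ] {m : ℕ} (P : Measure Ω) (ℱ : Filtration ℕ mΩ) (D : Measure Ξ)
    (τ K : ℕ) (M : ℕ → ℕ) (J : ℕ → Fin m → Ω → ℕ) (i : ℕ → Ω → Fin m)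
    (ξ : ℕ → ℕ → Ω → Ξ) : Prop where
  delay_measurable : ∀ k < K, ∀ p, Measurable[ℱ k] (J (k + 1) p)
  delay_le : ∀ k < K, ∀ p ω, J (k + 1) p ω ≤ k
  le_delay_add : ∀ k < K, ∀ p ω, k ≤ J (k + 1) p ω + τ
  block_measurable : ∀ k < K, Measurable[ℱ (k + 1)] (i k)
  sample_measurable : ∀ k < K, ∀ r < M (k + 1), Measurable[ℱ (k + 1)] (ξ (k + 1) r)
  law : ∀ k < K,
    P.map (fun ω => (i k ω, fun r : Fin (M (k + 1)) => ξ (k + 1) r ω))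
      = (uniformOn (Set.univ : Set (Fin m))).prod (Measure.pi fun _ => D)
  indep : ∀ k < K,
    Indep (MeasurableSpace.comap
      (fun ω => (i k ω, fun r : Fin (M (k + 1)) => ξ (k + 1) r ω)) inferInstance) (ℱ k) P

/-- `lam`, `zeta`, `eta`, `w` are the random iterates of the first `K` iterations of ASBCDS for
the stochastic function `Φ`, with step size `γ`, delay at most `τ`, starting point `x₀`, and
mini-batches of size `M k` for the `k`-th stochastic gradient (plain ASBCDS: `M k = 1`). -/
structure IsRandomASBCDS {Ω : Type u} {Ξ : Type v} [mΩ : MeasurableSpace Ω]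
    [MeasurableSpace Ξ] {m n : ℕ} (P : Measure Ω) (ℱ : Filtration ℕ mΩ) (D : Measure Ξ)
    (Φ : BlockVec m n → Ξ → ℝ) (γ : ℝ) (τ K : ℕ) (M : ℕ → ℕ)
    (J : ℕ → Fin m → Ω → ℕ) (i : ℕ → Ω → Fin m) (ξ : ℕ → ℕ → Ω → Ξ) (x₀ : BlockVec m n)
    (lam zeta eta w : ℕ → Ω → BlockVec m n) : Prop where
  sampling : IsAsyncSampling P ℱ D τ K M J i ξ
  run : ∀ ω, IsASBCDS γ K (fun k p => J k p ω) (fun k => i k ω)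
    (fun k => batchGrad Φ (M k) (fun r => ξ k r ω)) x₀
    (fun k => lam k ω) (fun k => zeta k ω) (fun k => eta k ω) (fun k => w k ω)

/-- Number of calls of the stochastic partial gradient oracle in `K` iterations: the `k`-th
stochastic gradient takes one call, for the chosen block, for each of its `M k` samples. -/
def oracleCalls (M : ℕ → ℕ) (K : ℕ) : ℕ := ∑ k ∈ Finset.Icc 1 K, M k

/-- The quantity `3Lγ + 12Lγ((τ² + τ)/m + 2τ)²`. -/
def stepQuantity (m τ : ℕ) (L γ : ℝ) : ℝ :=
  3 * L * γ + 12 * L * γ * (((τ : ℝ) ^ 2 + τ) / m + 2 * τ) ^ 2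

end

/-! ### The sequence `theta` -/

/-! The proof is an accelerated-gradient potential argument in which staleness enters only as a
perturbation. With `t_k = 1/θ_k`, the potential is `t_k² (φ(η_k) - φ(η*)) + m²/(2γ) ‖ζ_k - η*‖²`,
and `t_{k+1}² - t_{k+1} = t_k²` makes it telescope.

Along a realization, the descent lemma at `λ_{k+1}` and the expansion of `‖ζ_{k+1} - η*‖²` bound the
new potential by terms that are linear or quadratic in the sampled block of the gradient estimator
(`potential_succ_le`). In the linear term that block is paired with a vector known before the draw,
so averaging over samples and block turns it into `1/m` times an inner product with `∇φ(ω)`.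
Convexity and smoothness at `ω` bound the result (`model_le`), leaving an error of order `‖λ - ω‖²`
and a gain of order `‖∇φ(ω)‖²`.

The compensated point `ω` is built so that `λ - ω` is small. The momentum `λ_{l+1} - η_l` is `d_l`
times its predecessor, up to `1/m` of the random step `η_l - λ_l`. Extrapolating with the products
of the `d_l` therefore leaves only a weighted sum of the last `τ + 1` random steps
(`norm_sub_compensated_le`), and the expected square of each step is `γ²/m` times the second moment
of its estimator. Since `τ ≤ m`, `t_k` changes by a bounded factor over such a window, so the summed
error is a multiple of the summed gains (`sum_sq_invTheta_mul_delay_le`); the step size condition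
makes the multiple small enough (`delay_error_le`).

What remains is the initial potential, of order `m² (L + 1/γ) ‖η_0 - η*‖²`, plus noise of at most
`t_K² ε/2`. Division by `t_K² ≥ K²/4`, with `1/γ` of order `L τ²`, gives (i). For (ii), batches
proportional to `t_k` enforce the variance bound and cost about `∑ t_k ≤ t_K²`. -/

theorem theta_pos {m : ℕ} (hm : 1 ≤ m) : ∀ k, 0 < theta m k
  | 0 => by simp [theta]
  | 1 => by
      have : (0 : ℝ) < m := by exact_mod_cast hm
      simp only [theta]; positivity
  | (k + 2) => by
      have h := theta_pos hm (k + 1)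
      simp only [theta]
      have : theta m (k + 1) ^ 2 < √(theta m (k + 1) ^ 4 + 4 * theta m (k + 1) ^ 2) := by
        apply Real.lt_sqrt_of_sq_lt
        have : 0 < theta m (k + 1) ^ 2 := by positivity
        nlinarith
      linarith

theorem theta_sq_succ {m : ℕ} (k : ℕ) :
    theta m (k + 2) ^ 2 = (1 - theta m (k + 2)) * theta m (k + 1) ^ 2 := by
  simp only [theta]
  set a := theta m (k + 1)
  have : √(a ^ 4 + 4 * a ^ 2) ^ 2 = a ^ 4 + 4 * a ^ 2 := Real.sq_sqrt (by positivity)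
  nlinarith

/-- The reciprocals `1 / θ_k`. -/
noncomputable def invTheta (m k : ℕ) : ℝ := (theta m k)⁻¹

theorem invTheta_pos {m : ℕ} (hm : 1 ≤ m) (k : ℕ) : 0 < invTheta m k :=
  inv_pos.2 (theta_pos hm k)

theorem invTheta_one (m : ℕ) : invTheta m 1 = m := by simp [invTheta, theta]

theorem theta_mul_invTheta {m : ℕ} (hm : 1 ≤ m) (k : ℕ) : theta m k * invTheta m k = 1 :=
  mul_inv_cancel₀ (theta_pos hm k).ne'

/-- This identity drives the telescoping: the weight an iteration puts on its new function value is
exactly the weight the next iteration needs on its old one. -/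
theorem invTheta_sq_sub {m : ℕ} (hm : 1 ≤ m) (k : ℕ) :
    invTheta m (k + 2) ^ 2 - invTheta m (k + 2) = invTheta m (k + 1) ^ 2 := by
  have h1 := (theta_pos hm (k + 1)).ne'
  have h2 := (theta_pos hm (k + 2)).ne'
  have h := theta_sq_succ (m := m) k
  unfold invTheta
  field_simp
  linarith

theorem invTheta_add_half_le {m : ℕ} (hm : 1 ≤ m) (k : ℕ) :
    invTheta m (k + 1) + 1 / 2 ≤ invTheta m (k + 2) := by
  have h := invTheta_sq_sub hm k
  have h1 := invTheta_pos hm (k + 1)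
  have h2 := invTheta_pos hm (k + 2)
  by_contra! hlt
  have : 1 < invTheta m (k + 2) := by nlinarith
  nlinarith

theorem cast_le_invTheta {m : ℕ} (hm : 1 ≤ m) (k : ℕ) :
    (m : ℝ) + k / 2 ≤ invTheta m (k + 1) := by
  induction k with
  | zero => simp [invTheta_one]
  | succ k ih =>
    have := invTheta_add_half_le hm k
    push_cast at *
    linarith

theorem one_le_invTheta {m : ℕ} (hm : 1 ≤ m) : ∀ k, 1 ≤ invTheta m k
  | 0 => by simp [invTheta, theta]
  | k + 1 => by
      have h := cast_le_invTheta hm k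
      have : (1 : ℝ) ≤ m := by exact_mod_cast hm
      have : (0 : ℝ) ≤ k / 2 := by positivity
      linarith

theorem invTheta_mono_succ {m : ℕ} (hm : 1 ≤ m) : ∀ k, invTheta m k ≤ invTheta m (k + 1)
  | 0 => by
      have : invTheta m 0 = 1 := by simp [invTheta, theta]
      rw [this]
      exact one_le_invTheta hm 1
  | k + 1 => by linarith [invTheta_add_half_le hm k]

/-- The positive root `(1 + √(1 + 4t²))/2` exceeds `t` by at most `1/2 + 1/(8t)`, and `t ≥ 1`. -/
theorem invTheta_succ_le {m : ℕ} (hm : 1 ≤ m) (k : ℕ) :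
    invTheta m (k + 2) ≤ invTheta m (k + 1) + 5 / 8 := by
  have h := invTheta_sq_sub hm k
  have h1 := one_le_invTheta hm (k + 1)
  have h2 := one_le_invTheta hm (k + 2)
  by_contra! hlt
  nlinarith

theorem invTheta_add_le {m : ℕ} (hm : 1 ≤ m) (k r : ℕ) :
    invTheta m (k + 1 + r) ≤ invTheta m (k + 1) + 5 / 8 * r := by
  induction r with
  | zero => simp
  | succ r ih =>
    have := invTheta_succ_le hm (k + r)
    rw [show k + 1 + (r + 1) = k + r + 2 by ring]
    rw [show k + 1 + r = k + r + 1 by ring] at ih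
    push_cast
    linarith

/-- Over a window of length `m + 1` the reciprocals of `θ` grow at most by the factor `9/4`. -/
theorem invTheta_add_le_mul {m : ℕ} (hm : 1 ≤ m) (k r : ℕ) (hr : r ≤ m + 1) :
    invTheta m (k + 1 + r) ≤ 9 / 4 * invTheta m (k + 1) := by
  have h1 := invTheta_add_le hm k r
  have h2 := cast_le_invTheta hm k
  -- The factor is `1 + 5/4`: the increase is at most `5/8 (m + 1) ≤ 5/4 m`, and `m` is at most the
  -- initial reciprocal.
  have h3 : (r : ℝ) ≤ m + 1 := by exact_mod_cast hr
  have h4 : (1 : ℝ) ≤ m := by exact_mod_cast hm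
  have : (0 : ℝ) ≤ k / 2 := by positivity
  linarith

/-- Each term after the first is a difference of consecutive squares, by `invTheta_sq_sub`; the
first is `m ≤ m²`. -/
theorem sum_invTheta_le {m : ℕ} (hm : 1 ≤ m) (K : ℕ) :
    ∑ k ∈ Finset.range K, invTheta m (k + 1) ≤ invTheta m K ^ 2 := by
  have h4 : (1 : ℝ) ≤ m := by exact_mod_cast hm
  cases K with
  | zero => simpa using sq_nonneg _
  | succ K =>
    induction K with
    | zero => simp [invTheta_one]; nlinarith
    | succ K ih =>
      rw [Finset.sum_range_succ]
      linarith [invTheta_sq_sub hm K]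

theorem theta_le_one {m : ℕ} (hm : 1 ≤ m) (k : ℕ) : theta m k ≤ 1 := by
  have := inv_le_one_of_one_le₀ (one_le_invTheta hm k)
  rwa [invTheta, inv_inv] at this

theorem theta_succ_le {m : ℕ} (hm : 1 ≤ m) (k : ℕ) : theta m (k + 1) ≤ theta m k := by
  have := inv_anti₀ (invTheta_pos hm k) (invTheta_mono_succ hm k)
  rwa [invTheta, invTheta, inv_inv, inv_inv] at this

theorem cast_mul_theta_le {m : ℕ} (hm : 1 ≤ m) (k : ℕ) : m * theta m (k + 1) ≤ 1 := by
  have h1 := cast_le_invTheta hm k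
  have h2 := theta_mul_invTheta hm (k + 1)
  have h3 := theta_pos hm (k + 1)
  have : (0 : ℝ) ≤ k / 2 := by positivity
  nlinarith

theorem dCoef_nonneg {m : ℕ} (hm : 1 ≤ m) (k : ℕ) : 0 ≤ dCoef m k :=
  div_nonneg (mul_nonneg (theta_pos hm _).le (by linarith [theta_le_one hm k])) (theta_pos hm _).le

theorem dCoef_le_one {m : ℕ} (hm : 1 ≤ m) (k : ℕ) : dCoef m k ≤ 1 := by
  rw [dCoef, div_le_one (theta_pos hm k)]
  nlinarith [theta_succ_le hm k, theta_le_one hm k, theta_pos hm k, theta_pos hm (k + 1)]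

theorem dCoef_zero (m : ℕ) : dCoef m 0 = 0 := by simp [dCoef, theta]

/-! ### The error of the compensated points -/

section Extrapolation

variable {V : Type*} [NormedAddCommGroup V] [NormedSpace ℝ V]

/-- In the application `x` is a block of `eta` and `y` the same block of `lam`. The momentum obeys a
linear recursion up to a defect at each step; factors `d l ≤ 1` never amplify earlier defects, so
they just add up. -/
theorem norm_momentum_sub_le {d : ℕ → ℝ} {b : ℝ} {x y : ℕ → V} {j k : ℕ}
    (hd0 : ∀ l, 0 ≤ d l) (hd1 : ∀ l, d l ≤ 1)
    (h : ∀ l, l ≤ k → ‖y (l + 1) - x l - d l • (y l - x (l - 1))‖ ≤ b * ‖x l - y l‖)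
    {l : ℕ} (hjl : j ≤ l) (hlk : l ≤ k) :
    ‖y (l + 1) - x l - (∏ q ∈ Finset.Icc j l, d q) • (y j - x (j - 1))‖
      ≤ b * ∑ q ∈ Finset.Icc j l, ‖x q - y q‖ := by
  induction l, hjl using Nat.le_induction with
  | base => simpa using h j hlk
  | succ l hjl ih =>
    have ih := ih (by omega)
    rw [Finset.prod_Icc_succ_top (by omega), Finset.sum_Icc_succ_top (by omega), mul_add]
    have hl := h (l + 1) hlk
    rw [Nat.add_sub_cancel] at hl
    have key : y (l + 1 + 1) - x (l + 1)
          - ((∏ q ∈ Finset.Icc j l, d q) * d (l + 1)) • (y j - x (j - 1))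
        = d (l + 1) • (y (l + 1) - x l - (∏ q ∈ Finset.Icc j l, d q) • (y j - x (j - 1)))
          + (y (l + 1 + 1) - x (l + 1) - d (l + 1) • (y (l + 1) - x l)) := by
      module
    rw [key]
    refine (norm_add_le _ _).trans (add_le_add ?_ hl)
    rw [norm_smul, Real.norm_of_nonneg (hd0 _)]
    exact (mul_le_of_le_one_left (norm_nonneg _) (hd1 _)).trans ih

/-- The path from `x j` to `y (k + 1)` consists of the momenta `y (l + 1) - x l` for `j ≤ l ≤ k` and
the steps `x l - y l` for `j < l ≤ k`. The steps contribute weight `1`, except at `q = j`. The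
defect at `q` enters the predicted momenta for all `l` from `q` to `k`, hence `k + 1 - q` times. -/
theorem norm_sub_extrapolation_le {d : ℕ → ℝ} {b : ℝ} {x y : ℕ → V} {j k : ℕ}
    (hd0 : ∀ l, 0 ≤ d l) (hd1 : ∀ l, d l ≤ 1)
    (h : ∀ l, l ≤ k → ‖y (l + 1) - x l - d l • (y l - x (l - 1))‖ ≤ b * ‖x l - y l‖)
    (hjk : j ≤ k) :
    ‖y (k + 1)
        - (x j + ∑ l ∈ Finset.Icc j k, (∏ q ∈ Finset.Icc j l, d q) • (y j - x (j - 1)))‖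
      ≤ ∑ q ∈ Finset.Icc j k,
          (b * ((k + 1 - q : ℕ) : ℝ) + if q = j then 0 else 1) * ‖x q - y q‖ := by
  induction k, hjk using Nat.le_induction with
  | base =>
    have h1 := norm_momentum_sub_le (j := j) hd0 hd1 h le_rfl le_rfl
    simp only [Finset.Icc_self, Finset.sum_singleton, Finset.prod_singleton] at h1 ⊢
    rw [← sub_sub]
    simpa using h1
  | succ k hjk ih =>
    have ih := ih (fun l hl => h l (by omega))
    have h1 := norm_momentum_sub_le (j := j) hd0 hd1 h (l := k + 1) (by omega) le_rfl
    rw [Finset.sum_Icc_succ_top (by omega)]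
    have key : y (k + 1 + 1)
          - (x j + (∑ l ∈ Finset.Icc j k, (∏ q ∈ Finset.Icc j l, d q) • (y j - x (j - 1))
            + (∏ q ∈ Finset.Icc j (k + 1), d q) • (y j - x (j - 1))))
        = (y (k + 1)
          - (x j + ∑ l ∈ Finset.Icc j k, (∏ q ∈ Finset.Icc j l, d q) • (y j - x (j - 1))))
          + ((x (k + 1) - y (k + 1))
          + (y (k + 1 + 1) - x (k + 1)
              - (∏ q ∈ Finset.Icc j (k + 1), d q) • (y j - x (j - 1)))) := by
      abel
    rw [key]
    refine (norm_add_le _ _).trans ((add_le_add ih ((norm_add_le _ _).trans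
      (add_le_add le_rfl h1))).trans (le_of_eq ?_))
    rw [Finset.sum_Icc_succ_top (by omega), Finset.sum_Icc_succ_top (by omega), mul_add,
      Finset.mul_sum]
    have e : ∀ q ∈ Finset.Icc j k,
        (b * ((k + 1 + 1 - q : ℕ) : ℝ) + if q = j then 0 else 1) * ‖x q - y q‖
          = (b * ((k + 1 - q : ℕ) : ℝ) + if q = j then 0 else 1) * ‖x q - y q‖
            + b * ‖x q - y q‖ := by
      intro q hq
      have hq := (Finset.mem_Icc.1 hq).2
      rw [show k + 1 + 1 - q = (k + 1 - q) + 1 by omega]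
      push_cast
      ring
    rw [Finset.sum_congr rfl e, Finset.sum_add_distrib, if_neg (by omega)]
    simp
    ring

end Extrapolation

/-- The weight with which the step made `r` iterations ago enters the error of the compensated
point, when the delay is at most `τ`. -/
noncomputable def delayWeight (m τ r : ℕ) : ℝ :=
  if r ≤ τ + 1 then (r : ℝ) / m + (if r ≤ τ then 1 else 0) else 0

theorem delayWeight_nonneg (m τ r : ℕ) : 0 ≤ delayWeight m τ r := by
  unfold delayWeight
  split_ifs <;> positivity

/-- The sum of the delay weights. -/
noncomputable def delaySum (m τ : ℕ) : ℝ := ∑ r ∈ Finset.Icc 1 (τ + 1), delayWeight m τ r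

theorem delaySum_nonneg (m τ : ℕ) : 0 ≤ delaySum m τ :=
  Finset.sum_nonneg fun _ _ => delayWeight_nonneg _ _ _

theorem delaySum_eq (m τ : ℕ) :
    delaySum m τ = ((τ : ℝ) + 1) * (τ + 2) / 2 / m + τ := by
  have h1 : delaySum m τ
      = ∑ r ∈ Finset.Icc 1 (τ + 1), ((r : ℝ) / m + (if r ≤ τ then 1 else 0)) :=
    Finset.sum_congr rfl fun r hr => if_pos (Finset.mem_Icc.1 hr).2
  have h2 : ∀ N : ℕ, ∑ r ∈ Finset.Icc 1 N, (r : ℝ) = N * (N + 1) / 2 := by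
    intro N
    induction N with
    | zero => simp
    | succ N ih =>
      rw [Finset.sum_Icc_succ_top (by omega), ih]
      push_cast
      ring
  have h3 : ∑ r ∈ Finset.Icc 1 τ, (if r ≤ τ then (1 : ℝ) else 0) = τ := by
    rw [Finset.sum_congr rfl fun r hr => if_pos (Finset.mem_Icc.1 hr).2]
    simp
  rw [h1, Finset.sum_add_distrib, ← Finset.sum_div, h2, Finset.sum_Icc_succ_top (by omega), h3,
    if_neg (by omega)]
  push_cast
  ring

/-- The right-hand side is the quantity squared in `stepQuantity`; this is how the step size
condition meets the delay error. -/
theorem delaySum_le {m τ : ℕ} (hm : 1 ≤ m) (hτ : 1 ≤ τ) :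
    delaySum m τ ≤ ((τ : ℝ) ^ 2 + τ) / m + 2 * τ := by
  have hm' : (1 : ℝ) ≤ m := by exact_mod_cast hm
  have hτ' : (1 : ℝ) ≤ τ := by exact_mod_cast hτ
  have h0 : (0 : ℝ) < m := by linarith
  have : ((τ : ℝ) + 1) * (τ + 2) / 2 / m ≤ ((τ : ℝ) ^ 2 + τ) / m + τ := by
    rw [div_add' _ _ _ h0.ne']
    gcongr
    nlinarith
  rw [delaySum_eq]
  linarith

theorem sum_Icc_delayWeight_le (m τ N : ℕ) :
    ∑ r ∈ Finset.Icc 1 N, delayWeight m τ r ≤ delaySum m τ := by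
  rw [delaySum, ← Finset.sum_filter_add_sum_filter_not (Finset.Icc 1 N) (· ≤ τ + 1)]
  have h2 : ∑ r ∈ Finset.Icc 1 N with ¬ r ≤ τ + 1, delayWeight m τ r = 0 :=
    Finset.sum_eq_zero fun r hr => if_neg (Finset.mem_filter.1 hr).2
  rw [h2, add_zero]
  refine Finset.sum_le_sum_of_subset_of_nonneg ?_ fun _ _ _ => delayWeight_nonneg _ _ _
  intro r hr
  simp only [Finset.mem_filter, Finset.mem_Icc] at *
  omega

theorem sum_delayWeight_le (m τ k : ℕ) :
    ∑ q ∈ Finset.range (k + 1), delayWeight m τ (k + 1 - q) ≤ delaySum m τ := by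
  have h1 : ∑ q ∈ Finset.range (k + 1), delayWeight m τ (k + 1 - q)
      = ∑ r ∈ Finset.Icc 1 (k + 1), delayWeight m τ r := by
    refine Finset.sum_nbij' (fun q => k + 1 - q) (fun r => k + 1 - r) ?_ ?_ ?_ ?_ ?_ <;>
      intro q hq <;> simp only [Finset.mem_range, Finset.mem_Icc] at * <;> omega
  rw [h1]
  exact sum_Icc_delayWeight_le m τ (k + 1)

namespace IsASBCDS

variable {m n : ℕ} {γ : ℝ} {K : ℕ} {J : ℕ → Fin m → ℕ} {i : ℕ → Fin m}
  {G : ℕ → BlockVec m n → BlockVec m n} {x₀ : BlockVec m n} {lam zeta eta w : ℕ → BlockVec m n}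

/-- The momentum equals `θ (ζ - η)`. Without the random change of `zeta` it would be multiplied by
exactly `d`, which is what the compensation imitates. -/
theorem momentum_sub (h : IsASBCDS γ K J i G x₀ lam zeta eta w) (hm : 1 ≤ m) {l : ℕ}
    (hl : l + 1 < K) :
    lam (l + 2) - eta (l + 1) - dCoef m (l + 1) • (lam (l + 1) - eta l)
      = (theta m (l + 2) * (1 - m * theta m (l + 1))) • (zeta (l + 1) - zeta l) := by
  have hd : dCoef m (l + 1) * theta m (l + 1) = theta m (l + 2) * (1 - theta m (l + 1)) :=
    div_mul_cancel₀ _ (theta_pos hm (l + 1)).ne'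
  rw [h.lam_succ (l + 1) hl, h.eta_succ l (by omega), h.lam_succ l (by omega)]
  match_scalars
  · ring
  · linear_combination -hd
  · linear_combination hd

theorem norm_momentum_sub_le (h : IsASBCDS γ K J i G x₀ lam zeta eta w) (hm : 1 ≤ m) (p : Fin m)
    {l : ℕ} (hl : l < K) :
    ‖lam (l + 1) p - eta l p - dCoef m l • (lam l p - eta (l - 1) p)‖
      ≤ (m : ℝ)⁻¹ * ‖eta l p - lam l p‖ := by
  cases l with
  | zero =>
    -- There is no momentum at the start; the convention `θ₀ = 1` gives `d₀ = 0`, so the recursion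
    -- also covers stale index `0`.
    have : lam 1 = eta 0 := by
      rw [h.lam_succ 0 hl, h.zeta_zero, h.eta_zero]
      module
    simp [this, dCoef_zero, h.eta_zero, h.lam_zero]
  | succ l =>
    have h1 := congrArg (fun x : BlockVec m n => x p) (h.momentum_sub hm hl)
    have h2 := congrArg (fun x : BlockVec m n => x p) (h.eta_succ l (by omega))
    simp only [PiLp.sub_apply, PiLp.smul_apply, PiLp.add_apply] at h1 h2
    rw [Nat.add_sub_cancel, h1, h2, add_sub_cancel_left, norm_smul, norm_smul, ← mul_assoc]
    have h0 : (0 : ℝ) < m := by exact_mod_cast hm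
    have h3 := theta_pos hm (l + 1)
    have h4 := theta_pos hm (l + 2)
    have h5 := cast_mul_theta_le hm l
    have h6 := theta_succ_le hm (l + 1)
    gcongr
    rw [Real.norm_of_nonneg (mul_pos h0 h3).le, inv_mul_cancel_left₀ h0.ne',
      Real.norm_of_nonneg (mul_nonneg h4.le (by linarith))]
    nlinarith [mul_pos h0 h3]

theorem norm_sub_compensated_le (h : IsASBCDS γ K J i G x₀ lam zeta eta w) (hm : 1 ≤ m) {τ k : ℕ}
    (hk : k < K) (p : Fin m) (hJ : J (k + 1) p ≤ k) (hJτ : k ≤ J (k + 1) p + τ) :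
    ‖lam (k + 1) p - w (k + 1) p‖
      ≤ ∑ q ∈ Finset.range (k + 1), delayWeight m τ (k + 1 - q) * ‖eta q p - lam q p‖ := by
  have h1 := norm_sub_extrapolation_le (d := dCoef m) (b := (m : ℝ)⁻¹) (x := fun l => eta l p)
    (y := fun l => lam l p) (j := J (k + 1) p) (k := k) (dCoef_nonneg hm) (dCoef_le_one hm)
    (fun l hl => h.norm_momentum_sub_le hm p (by omega)) hJ
  rw [h.w_succ k hk p]
  refine h1.trans ?_
  refine (Finset.sum_le_sum fun q hq => ?_).trans
    (Finset.sum_le_sum_of_subset_of_nonneg (t := Finset.range (k + 1)) ?_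
      fun q _ _ => mul_nonneg (delayWeight_nonneg m τ _) (norm_nonneg _))
  · have hq := Finset.mem_Icc.1 hq
    gcongr
    have hq' : k + 1 - q ≤ τ + 1 := by omega
    rw [delayWeight, if_pos hq', div_eq_inv_mul]
    -- The largest lag `τ + 1` occurs only at the stale index itself, where the step weight `1` is
    -- absent; hence the two cut-offs in `delayWeight`.
    by_cases hqJ : q = J (k + 1) p
    · rw [if_pos hqJ]
      split_ifs <;> simp
    · have hq'' : k + 1 - q ≤ τ := by omega
      rw [if_neg hqJ, if_pos hq'']
  · intro q hq
    have hq := Finset.mem_Icc.1 hq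
    exact Finset.mem_range.2 (by omega)

/-- Weighted Cauchy–Schwarz in each block. The stale index varies with the block but the weights do
not, so the blocks recombine into full norms. -/
theorem sq_norm_sub_compensated_le (h : IsASBCDS γ K J i G x₀ lam zeta eta w) (hm : 1 ≤ m)
    {τ k : ℕ} (hk : k < K) (hJ : ∀ p, J (k + 1) p ≤ k) (hJτ : ∀ p, k ≤ J (k + 1) p + τ) :
    ‖lam (k + 1) - w (k + 1)‖ ^ 2
      ≤ delaySum m τ * ∑ q ∈ Finset.range (k + 1),
          delayWeight m τ (k + 1 - q) * ‖eta q - lam q‖ ^ 2 := by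
  have h1 : ∀ p, ‖lam (k + 1) p - w (k + 1) p‖ ^ 2
      ≤ delaySum m τ * ∑ q ∈ Finset.range (k + 1),
          delayWeight m τ (k + 1 - q) * ‖eta q p - lam q p‖ ^ 2 := by
    intro p
    have h2 := h.norm_sub_compensated_le hm hk p (hJ p) (hJτ p)
    have h3 := Finset.sum_sq_le_sum_mul_sum_of_sq_le_mul (Finset.range (k + 1))
      (r := fun q => delayWeight m τ (k + 1 - q) * ‖eta q p - lam q p‖)
      (f := fun q => delayWeight m τ (k + 1 - q))
      (g := fun q => delayWeight m τ (k + 1 - q) * ‖eta q p - lam q p‖ ^ 2)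
      (fun q _ => delayWeight_nonneg _ _ _)
      (fun q _ => mul_nonneg (delayWeight_nonneg _ _ _) (sq_nonneg _)) (fun q _ => le_of_eq (by ring))
    refine (pow_le_pow_left₀ (norm_nonneg _) h2 2).trans (h3.trans ?_)
    exact mul_le_mul_of_nonneg_right (sum_delayWeight_le m τ k)
      (Finset.sum_nonneg fun q _ => mul_nonneg (delayWeight_nonneg _ _ _) (sq_nonneg _))
  rw [PiLp.norm_sq_eq_of_L2]
  refine (Finset.sum_le_sum fun p _ => h1 p).trans (le_of_eq ?_)
  rw [← Finset.mul_sum, Finset.sum_comm]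
  congr 1
  refine Finset.sum_congr rfl fun q _ => ?_
  rw [PiLp.norm_sq_eq_of_L2, Finset.mul_sum]
  rfl

end IsASBCDS

/-! ### Smooth convex functions -/

section Smooth

variable {V : Type*} [NormedAddCommGroup V] [InnerProductSpace ℝ V] [CompleteSpace V]

theorem hasDerivAt_comp_line {f : V → ℝ} (hf : Differentiable ℝ f) (x v : V) (s : ℝ) :
    HasDerivAt (fun s : ℝ => f (x + s • v)) (inner ℝ (gradient f (x + s • v)) v) s := by
  have h1 : HasDerivAt (fun s : ℝ => x + s • v) v s := by
    simpa using ((hasDerivAt_id s).smul_const v).const_add x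
  rw [inner_gradient_left]
  exact (hf _).hasFDerivAt.comp_hasDerivAt s h1

/-- The descent lemma. -/
theorem le_add_inner_gradient_add {f : V → ℝ} {L : ℝ} (hf : Differentiable ℝ f)
    (hL : ∀ x y, ‖gradient f x - gradient f y‖ ≤ L * ‖x - y‖) (x y : V) :
    f y ≤ f x + inner ℝ (gradient f x) (y - x) + L / 2 * ‖y - x‖ ^ 2 := by
  set v := y - x with hv
  have hd : ∀ s : ℝ, HasDerivAt
      (fun s : ℝ => f (x + s • v) - s * inner ℝ (gradient f x) v - L / 2 * ‖v‖ ^ 2 * s ^ 2)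
      (inner ℝ (gradient f (x + s • v)) v - inner ℝ (gradient f x) v - L * ‖v‖ ^ 2 * s) s := by
    intro s
    have h1 := ((hasDerivAt_comp_line hf x v s).sub
      ((hasDerivAt_id s).mul_const (inner ℝ (gradient f x) v))).sub
      (((hasDerivAt_id s).pow 2).const_mul (L / 2 * ‖v‖ ^ 2))
    refine h1.congr_deriv ?_
    simp only [id]
    ring
  have hanti : AntitoneOn
      (fun s : ℝ => f (x + s • v) - s * inner ℝ (gradient f x) v - L / 2 * ‖v‖ ^ 2 * s ^ 2)
      (Set.Icc 0 1) := by
    refine antitoneOn_of_deriv_nonpos (convex_Icc 0 1)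
      (fun s _ => (hd s).continuousAt.continuousWithinAt)
      (fun s _ => (hd s).differentiableAt.differentiableWithinAt) fun s hs => ?_
    rw [interior_Icc] at hs
    rw [(hd s).deriv, ← inner_sub_left]
    have h2 := real_inner_le_norm (gradient f (x + s • v) - gradient f x) v
    have h3 := hL (x + s • v) x
    rw [add_sub_cancel_left, norm_smul, Real.norm_of_nonneg hs.1.le] at h3
    nlinarith [norm_nonneg v, mul_le_mul_of_nonneg_right h3 (norm_nonneg v)]
  have := hanti (Set.left_mem_Icc.2 zero_le_one) (Set.right_mem_Icc.2 zero_le_one) zero_le_one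
  simp [hv] at this
  simp only [hv, inner_gradient_left, map_sub]
  linarith

/-- The first-order condition for convexity. -/
theorem ConvexOn.add_inner_gradient_le {f : V → ℝ} (hc : ConvexOn ℝ Set.univ f)
    (hf : Differentiable ℝ f) (x y : V) :
    f x + inner ℝ (gradient f x) (y - x) ≤ f y := by
  have hc' : ConvexOn ℝ Set.univ (fun s : ℝ => f (x + s • (y - x))) := by
    have := hc.comp_affineMap (AffineMap.lineMap x y)
    simpa [Function.comp_def, AffineMap.lineMap_apply, add_comm] using this
  have h1 := hasDerivAt_comp_line hf x (y - x) 0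
  have h2 := hc'.le_slope_of_hasDerivAt (Set.mem_univ 0) (Set.mem_univ 1) one_pos h1
  simp [slope_def_field] at h2 ⊢
  linarith

theorem IsMinOn.gradient_eq_zero {f : V → ℝ} {u : V} (hu : IsMinOn f Set.univ u) :
    gradient f u = 0 := by
  have : IsLocalMin f u := hu.isLocalMin Filter.univ_mem
  rw [gradient, this.fderiv_eq_zero, map_zero]

end Smooth

/-! ### One iteration along a realization -/

theorem inner_eq_of_eq_zero_off {m n : ℕ} (x y : BlockVec m n) (j : Fin m)
    (hy : ∀ p, p ≠ j → y p = 0) : inner ℝ x y = inner ℝ (x j) (y j) := by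
  rw [PiLp.inner_apply]
  exact Finset.sum_eq_single j (fun p _ hp => by rw [hy p hp, inner_zero_right]) (by simp)

namespace IsASBCDS

variable {m n : ℕ} {γ : ℝ} {K : ℕ} {J : ℕ → Fin m → ℕ} {i : ℕ → Fin m}
  {G : ℕ → BlockVec m n → BlockVec m n} {x₀ : BlockVec m n} {lam zeta eta w : ℕ → BlockVec m n}

theorem inner_zeta_sub (h : IsASBCDS γ K J i G x₀ lam zeta eta w) {k : ℕ} (hk : k < K)
    (x : BlockVec m n) :
    inner ℝ x (zeta (k + 1) - zeta k)
      = -(γ / (m * theta m (k + 1))) * inner ℝ (x (i k)) (G (k + 1) (w (k + 1)) (i k)) := by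
  rw [inner_eq_of_eq_zero_off x _ (i k), PiLp.sub_apply, h.zeta_succ_self k hk, sub_sub_cancel_left,
    inner_neg_right, inner_smul_right, neg_mul]
  intro p hp
  rw [PiLp.sub_apply, h.zeta_succ_other k hk p hp, sub_self]

theorem norm_sq_zeta_sub (h : IsASBCDS γ K J i G x₀ lam zeta eta w) {k : ℕ} (hk : k < K) :
    ‖zeta (k + 1) - zeta k‖ ^ 2
      = (γ / (m * theta m (k + 1))) ^ 2 * ‖G (k + 1) (w (k + 1)) (i k)‖ ^ 2 := by
  rw [← real_inner_self_eq_norm_sq, h.inner_zeta_sub hk, PiLp.sub_apply, h.zeta_succ_self k hk,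
    sub_sub_cancel_left, inner_neg_left, inner_smul_left, real_inner_self_eq_norm_sq]
  simp only [conj_trivial]
  ring

/-- The factors `m θ` cancel: `eta` makes a plain block gradient step of size `γ` from `lam`. -/
theorem inner_eta_sub (h : IsASBCDS γ K J i G x₀ lam zeta eta w) (hm : 1 ≤ m) {k : ℕ} (hk : k < K)
    (x : BlockVec m n) :
    inner ℝ x (eta (k + 1) - lam (k + 1))
      = -γ * inner ℝ (x (i k)) (G (k + 1) (w (k + 1)) (i k)) := by
  have h0 : (0 : ℝ) < m := by exact_mod_cast hm
  have h1 := theta_pos hm (k + 1)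
  rw [h.eta_succ k hk, add_sub_cancel_left, inner_smul_right, h.inner_zeta_sub hk]
  field_simp

theorem norm_sq_eta_sub (h : IsASBCDS γ K J i G x₀ lam zeta eta w) (hm : 1 ≤ m) {k : ℕ}
    (hk : k < K) :
    ‖eta (k + 1) - lam (k + 1)‖ ^ 2 = γ ^ 2 * ‖G (k + 1) (w (k + 1)) (i k)‖ ^ 2 := by
  have h0 : (0 : ℝ) < m := by exact_mod_cast hm
  have h1 := theta_pos hm (k + 1)
  rw [h.eta_succ k hk, add_sub_cancel_left, norm_smul, mul_pow, h.norm_sq_zeta_sub hk,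
    Real.norm_eq_abs, sq_abs]
  field_simp

/-- Descent lemma plus expansion of the square. The linear terms are merged into one inner product
whose left vector does not involve the current draw, ready for conditional averaging. -/
theorem potential_succ_le (h : IsASBCDS γ K J i G x₀ lam zeta eta w) (hm : 1 ≤ m) (hγ : 0 < γ)
    {L : ℝ} {φ : BlockVec m n → ℝ} (hφ : IsSmoothFun L φ) (u : BlockVec m n) {k : ℕ}
    (hk : k < K) :
    invTheta m (k + 1) ^ 2 * (φ (eta (k + 1)) - φ u) + m ^ 2 / (2 * γ) * ‖zeta (k + 1) - u‖ ^ 2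
      ≤ invTheta m (k + 1) ^ 2 * (φ (lam (k + 1)) - φ u) + m ^ 2 / (2 * γ) * ‖zeta k - u‖ ^ 2
        - inner ℝ (((invTheta m (k + 1) ^ 2 * γ) • gradient φ (lam (k + 1))
            + (invTheta m (k + 1) * m) • (zeta k - u)) (i k)) (G (k + 1) (w (k + 1)) (i k))
        + invTheta m (k + 1) ^ 2 * (γ / 2) * (1 + L * γ) * ‖G (k + 1) (w (k + 1)) (i k)‖ ^ 2 := by
  have h0 : (0 : ℝ) < m := by exact_mod_cast hm
  have h1 := theta_pos hm (k + 1)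
  have hd := le_add_inner_gradient_add hφ.1 hφ.2 (lam (k + 1)) (eta (k + 1))
  rw [h.inner_eta_sub hm hk, h.norm_sq_eta_sub hm hk] at hd
  have hz : ‖zeta (k + 1) - u‖ ^ 2 = ‖zeta k - u‖ ^ 2
      + 2 * inner ℝ (zeta k - u) (zeta (k + 1) - zeta k) + ‖zeta (k + 1) - zeta k‖ ^ 2 := by
    rw [← norm_add_sq_real]
    congr 2
    abel
  rw [h.inner_zeta_sub hk, h.norm_sq_zeta_sub hk] at hz
  rw [hz, PiLp.add_apply, PiLp.smul_apply, PiLp.smul_apply, inner_add_left, inner_smul_left,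
    inner_smul_left]
  simp only [conj_trivial]
  set a := ‖G (k + 1) (w (k + 1)) (i k)‖ ^ 2
  set b := inner ℝ ((zeta k - u) (i k)) (G (k + 1) (w (k + 1)) (i k))
  set e := inner ℝ (gradient φ (lam (k + 1)) (i k)) (G (k + 1) (w (k + 1)) (i k))
  have e1 : (m : ℝ) ^ 2 / (2 * γ) * (‖zeta k - u‖ ^ 2 + 2 * (-(γ / (m * theta m (k + 1))) * b)
      + (γ / (m * theta m (k + 1))) ^ 2 * a)
      = m ^ 2 / (2 * γ) * ‖zeta k - u‖ ^ 2 - invTheta m (k + 1) * m * b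
        + invTheta m (k + 1) ^ 2 * (γ / 2) * a := by
    unfold invTheta
    field_simp
    ring
  rw [e1]
  nlinarith [mul_le_mul_of_nonneg_left hd (sq_nonneg (invTheta m (k + 1)))]

/-- The coupling `t² λ = t ζ + (t² - t) η` splits the mirror term into inner products of `∇φ(ω)`
with displacements from `ω`. Convexity at `ω` handles `η` and `u`, the descent lemma handles `λ`,
and the values `φ(ω)` cancel. -/
theorem model_le (h : IsASBCDS γ K J i G x₀ lam zeta eta w) (hm : 1 ≤ m) (hγ : 0 < γ)
    {L : ℝ} {φ : BlockVec m n → ℝ} (hc : ConvexOn ℝ Set.univ φ) (hφ : IsSmoothFun L φ)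
    (u : BlockVec m n) {k : ℕ} (hk : k < K) :
    invTheta m (k + 1) ^ 2 * (φ (lam (k + 1)) - φ u)
        - 1 / m * inner ℝ ((invTheta m (k + 1) ^ 2 * γ) • gradient φ (lam (k + 1))
            + (invTheta m (k + 1) * m) • (zeta k - u)) (gradient φ (w (k + 1)))
      ≤ (invTheta m (k + 1) ^ 2 - invTheta m (k + 1)) * (φ (eta k) - φ u)
        + invTheta m (k + 1) ^ 2 * (L / 2 + 2 * L ^ 2 * γ / m) * ‖lam (k + 1) - w (k + 1)‖ ^ 2
        - 7 / 8 * (invTheta m (k + 1) ^ 2 * γ / m) * ‖gradient φ (w (k + 1))‖ ^ 2 := by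
  have h0 : (0 : ℝ) < m := by exact_mod_cast hm
  have h1 := theta_pos hm (k + 1)
  have ht := theta_mul_invTheta hm (k + 1)
  have ht1 := one_le_invTheta hm (k + 1)
  set t := invTheta m (k + 1)
  set g := gradient φ (w (k + 1)) with hg
  set y := lam (k + 1) with hy
  have hx := hc.add_inner_gradient_le hφ.1 (w (k + 1)) (eta k)
  have hu := hc.add_inner_gradient_le hφ.1 (w (k + 1)) u
  have hd := le_add_inner_gradient_add hφ.1 hφ.2 (w (k + 1)) y
  rw [← hg] at hx hu hd
  -- the mirror term
  have ez : t • (zeta k - u) = (t ^ 2) • (y - w (k + 1)) - (t ^ 2 - t) • (eta k - w (k + 1))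
      - t • (u - w (k + 1)) := by
    have : t ^ 2 • y = t • zeta k + (t ^ 2 - t) • eta k := by
      rw [hy, h.lam_succ k hk, smul_add, smul_smul, smul_smul]
      congr 2
      · linear_combination t * ht
      · linear_combination -t * ht
    rw [smul_sub, smul_sub, this]
    module
  have e1 : t * inner ℝ (zeta k - u) g = t ^ 2 * inner ℝ g (y - w (k + 1))
      - (t ^ 2 - t) * inner ℝ g (eta k - w (k + 1)) - t * inner ℝ g (u - w (k + 1)) := by
    have e := congrArg (inner ℝ g) ez
    rw [inner_sub_right, inner_sub_right] at e
    simp only [inner_smul_right] at e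
    rwa [real_inner_comm]
  -- the gradient term
  have e2 : 7 / 8 * ‖g‖ ^ 2 - 2 * L ^ 2 * ‖y - w (k + 1)‖ ^ 2 ≤ inner ℝ (gradient φ y) g := by
    have h2 : inner ℝ (gradient φ y) g = ‖g‖ ^ 2 + inner ℝ (gradient φ y - g) g := by
      rw [inner_sub_left, real_inner_self_eq_norm_sq]
      ring
    have h3 := neg_le_of_abs_le (abs_real_inner_le_norm (gradient φ y - g) g)
    have h4 := hφ.2 y (w (k + 1))
    have h5 := mul_le_mul_of_nonneg_right h4 (norm_nonneg g)
    -- Young's inequality `a b ≤ a²/8 + 2 b²`, giving up one eighth of `‖g‖²`.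
    nlinarith [sq_nonneg (‖g‖ - 4 * (L * ‖y - w (k + 1)‖))]
  have e3 : 1 / m * inner ℝ ((t ^ 2 * γ) • gradient φ y + (t * m) • (zeta k - u)) g
      = t ^ 2 * γ / m * inner ℝ (gradient φ y) g + t * inner ℝ (zeta k - u) g := by
    rw [inner_add_left, inner_smul_left, inner_smul_left]
    simp only [conj_trivial]
    field_simp
  rw [e3, e1]
  have h6 : 0 ≤ t ^ 2 - t := by nlinarith
  have h7 : 0 ≤ t ^ 2 * γ / m := by positivity
  have e4 := mul_le_mul_of_nonneg_left e2 h7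
  have e5 := mul_le_mul_of_nonneg_left hx h6
  have e6 := mul_le_mul_of_nonneg_left hu (show 0 ≤ t by linarith)
  have e7 := mul_le_mul_of_nonneg_left hd (sq_nonneg t)
  have e8 : t ^ 2 * (L / 2 + 2 * L ^ 2 * γ / m) * ‖y - w (k + 1)‖ ^ 2
      = t ^ 2 * (L / 2 * ‖y - w (k + 1)‖ ^ 2)
        + t ^ 2 * γ / m * (2 * L ^ 2 * ‖y - w (k + 1)‖ ^ 2) := by
    ring
  rw [e8]
  linarith

end IsASBCDS

/-! ### Sampling -/

/-- Needed for evaluation at a random index, both the stale index and the drawn block. -/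
theorem measurable_apply_countable {α β ι : Type*} {mα : MeasurableSpace α}
    {mβ : MeasurableSpace β} [MeasurableSpace ι] [Countable ι] [MeasurableSingletonClass ι]
    {F : ι → α → β} (hF : ∀ j, Measurable (F j)) {J : α → ι} (hJ : Measurable J) :
    Measurable (fun a => F (J a) a) := by
  have h : Measurable (fun q : α × ι => F q.2 q.1) := measurable_from_prod_countable_left hF
  exact h.comp (measurable_id.prodMk hJ)

theorem measurable_blockVec {α : Type*} {mα : MeasurableSpace α} {m n : ℕ}
    {f : α → BlockVec m n} (hf : ∀ p, Measurable (fun a => f a p)) : Measurable f :=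
  (WithLp.measurable_toLp 2 _).comp (measurable_pi_iff.2 hf)

theorem measurable_block {m n : ℕ} (p : Fin m) : Measurable (fun x : BlockVec m n => x p) :=
  (PiLp.continuous_apply 2 _ p).measurable

section Uniform

variable {Ω S : Type*} [MeasurableSpace Ω] [MeasurableSpace S] {P : Measure Ω} {m : ℕ}

theorem IndepFun.integral_apply_uniform {i : Ω → Fin m} {Q : Ω → S} [IsProbabilityMeasure P]
    (hi : Measurable i) (hQ : Measurable Q)
    (hlaw : P.map i = uniformOn Set.univ) (hind : IndepFun i Q P) {F : Fin m → S → ℝ}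
    (hF : ∀ p, Measurable (F p)) (hint : ∀ p, Integrable (fun ω => F p (Q ω)) P) :
    ∫ ω, F (i ω) (Q ω) ∂P = 1 / m * ∑ p, ∫ ω, F p (Q ω) ∂P := by
  have e1 : ∀ ω, F (i ω) (Q ω)
      = ∑ p, ({p} : Set (Fin m)).indicator (fun _ => (1 : ℝ)) (i ω) * F p (Q ω) := by
    intro ω
    rw [Finset.sum_eq_single (i ω)]
    · simp
    · intro p _ hp
      rw [Set.indicator_of_notMem (by simpa using hp.symm), zero_mul]
    · simp
  have hmeas : ∀ p : Fin m,
      Measurable (({p} : Set (Fin m)).indicator (fun _ => (1 : ℝ))) := fun p =>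
    measurable_const.indicator (measurableSet_singleton p)
  have e2 : ∀ p, ∫ ω, ({p} : Set (Fin m)).indicator (fun _ => (1 : ℝ)) (i ω) * F p (Q ω) ∂P
      = 1 / m * ∫ ω, F p (Q ω) ∂P := by
    intro p
    rw [hind.integral_fun_comp_mul_comp hi.aemeasurable hQ.aemeasurable
      (hmeas p).aestronglyMeasurable (hF p).aestronglyMeasurable]
    congr 1
    rw [← integral_map hi.aemeasurable (hmeas p).aestronglyMeasurable, hlaw,
      integral_indicator_const _ (measurableSet_singleton p), Measure.real, uniformOn_univ]
    simp
  simp_rw [e1]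
  rw [integral_finsetSum]
  · rw [Finset.mul_sum]
    exact Finset.sum_congr rfl fun p _ => e2 p
  · intro p _
    refine (hint p).bdd_mul (c := 1) ((hmeas p).comp hi).aestronglyMeasurable
      (Filter.Eventually.of_forall fun ω => ?_)
    rw [Real.norm_eq_abs, abs_le]
    by_cases hp : i ω = p <;> simp [hp]

end Uniform

section Triple

variable {Ω α β S : Type*} [MeasurableSpace Ω] [MeasurableSpace α] [MeasurableSpace β]
  [MeasurableSpace S] {P : Measure Ω} [IsProbabilityMeasure P]

/-- If `(X, Y)` has a product law and is independent of `H`, then `X` is independent of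
`(Y, H)`. -/
theorem indepFun_prodMk_of_map_prod {X : Ω → α} {Y : Ω → β} {H : Ω → S} {μ : Measure α}
    {ν : Measure β} [IsProbabilityMeasure μ] [IsProbabilityMeasure ν]
    (hX : Measurable X) (hY : Measurable Y) (hH : Measurable H)
    (hlaw : P.map (fun ω => (X ω, Y ω)) = μ.prod ν)
    (hind : IndepFun (fun ω => (X ω, Y ω)) H P) :
    IndepFun X (fun ω => (Y ω, H ω)) P := by
  have : IsProbabilityMeasure (P.map H) := Measure.isProbabilityMeasure_map hH.aemeasurable
  have hXlaw : P.map X = μ := by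
    have := congrArg (Measure.map Prod.fst) hlaw
    rwa [Measure.map_map measurable_fst (hX.prodMk hY), Measure.map_fst_prod, measure_univ,
      one_smul] at this
  have hYlaw : P.map Y = ν := by
    have := congrArg (Measure.map Prod.snd) hlaw
    rwa [Measure.map_map measurable_snd (hX.prodMk hY), Measure.map_snd_prod, measure_univ,
      one_smul] at this
  have hYH : IndepFun Y H P := hind.comp measurable_snd measurable_id
  have h1 := (indepFun_iff_map_prod_eq_prod_map_map (hX.prodMk hY).aemeasurable
    hH.aemeasurable).1 hind
  have h2 := (indepFun_iff_map_prod_eq_prod_map_map hY.aemeasurable hH.aemeasurable).1 hYH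
  rw [indepFun_iff_map_prod_eq_prod_map_map hX.aemeasurable (hY.prodMk hH).aemeasurable, h2, hXlaw,
    hYlaw]
  rw [hlaw] at h1
  have h3 := (measurePreserving_prodAssoc μ ν (P.map H)).map_eq
  rw [← h1, Measure.map_map MeasurableEquiv.prodAssoc.measurable ((hX.prodMk hY).prodMk hH)] at h3
  exact h3

end Triple

section Batch

/-- The average of the stochastic gradients over `N` samples. -/
noncomputable def finBatchGrad {m n : ℕ} {Ξ : Type v} (Φ : BlockVec m n → Ξ → ℝ) (N : ℕ) (s : Fin N → Ξ)
    (x : BlockVec m n) : BlockVec m n :=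
  (N : ℝ)⁻¹ • ∑ r, stochGrad Φ x (s r)

theorem batchGrad_eq_finBatchGrad {m n : ℕ} {Ξ : Type v} (Φ : BlockVec m n → Ξ → ℝ) (N : ℕ) (s : ℕ → Ξ) (x : BlockVec m n) :
    batchGrad Φ N s x = finBatchGrad Φ N (fun r => s r) x := by
  rw [batchGrad, finBatchGrad, Finset.sum_range]

variable {m n : ℕ} {Ξ : Type v} [MeasurableSpace Ξ] {D : Measure Ξ}
  {φ : BlockVec m n → ℝ} {Φ : BlockVec m n → Ξ → ℝ}

theorem IsStochasticModel.measurable_finBatchGrad (h : IsStochasticModel φ Φ D) (N : ℕ) :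
    Measurable (fun q : (Fin N → Ξ) × BlockVec m n => finBatchGrad Φ N q.1 q.2) := by
  unfold finBatchGrad
  refine Measurable.const_smul (Finset.measurable_fun_sum _ fun r _ => ?_) (N : ℝ)⁻¹
  exact h.measurable_grad.comp
    (measurable_snd.prodMk ((measurable_pi_apply r).comp measurable_fst))

variable [IsProbabilityMeasure D]

theorem IsStochasticModel.integrable_finBatchGrad (h : IsStochasticModel φ Φ D) (N : ℕ)
    (x : BlockVec m n) :
    Integrable (fun s => finBatchGrad Φ N s x) (Measure.pi fun _ : Fin N => D) :=
  Integrable.fun_smul (N : ℝ)⁻¹ (integrable_finsetSum _ fun _ _ =>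
    integrable_comp_eval (μ := fun _ : Fin N => D) (h.integrable_grad x))

theorem IsStochasticModel.integral_finBatchGrad (h : IsStochasticModel φ Φ D) {N : ℕ}
    (hN : 1 ≤ N) (x : BlockVec m n) :
    ∫ s, finBatchGrad Φ N s x ∂(Measure.pi fun _ : Fin N => D) = gradient φ x := by
  have hN' : (N : ℝ) ≠ 0 := by positivity
  unfold finBatchGrad
  rw [integral_smul, integral_finsetSum _ fun _ _ =>
    integrable_comp_eval (μ := fun _ : Fin N => D) (h.integrable_grad x)]
  have : ∀ r : Fin N, ∫ s : Fin N → Ξ, stochGrad Φ x (s r) ∂(Measure.pi fun _ : Fin N => D)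
      = gradient φ x := fun r => by
    rw [integral_comp_eval (μ := fun _ : Fin N => D) (h.integrable_grad x).aestronglyMeasurable,
      h.mean_grad]
  simp [this, ← Nat.cast_smul_eq_nsmul ℝ, smul_smul, hN']

/-- Given the past, the mini-batch gradient is an unbiased estimator of the gradient. -/
theorem IsStochasticModel.integral_inner_finBatchGrad (h : IsStochasticModel φ Φ D)
    {Ω : Type*} [MeasurableSpace Ω] {P : Measure Ω} [IsProbabilityMeasure P] {N : ℕ} (hN : 1 ≤ N)
    {Y : Ω → Fin N → Ξ} {X W : Ω → BlockVec m n} (hY : Measurable Y) (hX : Measurable X)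
    (hW : Measurable W) (hlaw : P.map Y = Measure.pi fun _ => D)
    (hind : IndepFun Y (fun ω => (X ω, W ω)) P)
    (hint : Integrable (fun ω => inner ℝ (X ω) (finBatchGrad Φ N (Y ω) (W ω))) P) :
    ∫ ω, inner ℝ (X ω) (finBatchGrad Φ N (Y ω) (W ω)) ∂P
      = ∫ ω, inner ℝ (X ω) (gradient φ (W ω)) ∂P := by
  have hXW := hX.prodMk hW
  have : IsProbabilityMeasure (P.map (fun ω => (X ω, W ω))) :=
    Measure.isProbabilityMeasure_map hXW.aemeasurable
  have h1 := (indepFun_iff_map_prod_eq_prod_map_map hY.aemeasurable hXW.aemeasurable).1 hind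
  rw [hlaw] at h1
  set F : (Fin N → Ξ) × (BlockVec m n × BlockVec m n) → ℝ := fun q =>
    inner ℝ q.2.1 (finBatchGrad Φ N q.1 q.2.2) with hF
  have hB : Measurable (fun q : (Fin N → Ξ) × (BlockVec m n × BlockVec m n) =>
      finBatchGrad Φ N q.1 q.2.2) :=
    Measurable.comp (f := fun q : (Fin N → Ξ) × (BlockVec m n × BlockVec m n) => (q.1, q.2.2))
      (h.measurable_finBatchGrad N)
      (measurable_fst.prodMk (measurable_snd.comp measurable_snd))
  have hX' : Measurable (fun q : (Fin N → Ξ) × (BlockVec m n × BlockVec m n) => q.2.1) :=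
    measurable_fst.comp measurable_snd
  have hFm : Measurable F := hX'.inner hB
  have hFint : Integrable F
      ((Measure.pi fun _ => D).prod (P.map (fun ω => (X ω, W ω)))) := by
    rw [← h1]
    exact (integrable_map_measure hFm.aestronglyMeasurable (hY.prodMk hXW).aemeasurable).2 hint
  have h2 : ∫ ω, F (Y ω, X ω, W ω) ∂P
      = ∫ q, F q ∂((Measure.pi fun _ => D).prod (P.map (fun ω => (X ω, W ω)))) := by
    rw [← h1, integral_map (hY.prodMk hXW).aemeasurable hFm.aestronglyMeasurable]
  have h3 : ∀ y : BlockVec m n × BlockVec m n,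
      ∫ s, F (s, y) ∂(Measure.pi fun _ => D) = inner ℝ y.1 (gradient φ y.2) := by
    intro y
    rw [← h.integral_finBatchGrad hN y.2, ← integral_inner (h.integrable_finBatchGrad N y.2)]
  -- Smoothness of `φ` is not assumed here; measurability comes from writing the function as a
  -- parametric integral.
  have h4 : Measurable (fun y : BlockVec m n × BlockVec m n => inner ℝ y.1 (gradient φ y.2)) := by
    simp_rw [← h3]
    exact (hFm.stronglyMeasurable.integral_prod_left' (μ := Measure.pi fun _ => D)).measurable
  have h5 := h2
  rw [integral_prod_symm _ hFint] at h5
  simp_rw [h3] at h5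
  rw [integral_map hXW.aemeasurable h4.aestronglyMeasurable] at h5
  exact h5

end Batch

/-! ### Measurability and square integrability of the random iterates -/

/-- The mini-batch gradient used in iteration `k - 1`, as a random vector. -/
noncomputable def randGrad {Ω : Type u} {Ξ : Type v} {m n : ℕ} (Φ : BlockVec m n → Ξ → ℝ)
    (M : ℕ → ℕ) (ξ : ℕ → ℕ → Ω → Ξ) (w : ℕ → Ω → BlockVec m n) (k : ℕ) (ω : Ω) : BlockVec m n :=
  batchGrad Φ (M k) (fun r => ξ k r ω) (w k ω)

theorem measurable_batchGrad {α : Type*} {mα : MeasurableSpace α} {Ξ : Type v} [MeasurableSpace Ξ]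
    {m n : ℕ} {D : Measure Ξ} {φ : BlockVec m n → ℝ} {Φ : BlockVec m n → Ξ → ℝ}
    (h : IsStochasticModel φ Φ D) {N : ℕ} {s : ℕ → α → Ξ} {x : α → BlockVec m n}
    (hs : ∀ r < N, Measurable (s r)) (hx : Measurable x) :
    Measurable (fun a => batchGrad Φ N (fun r => s r a) (x a)) := by
  unfold batchGrad
  refine Measurable.const_smul (Finset.measurable_fun_sum _ fun r hr => ?_) (N : ℝ)⁻¹
  exact h.measurable_grad.comp (hx.prodMk (hs r (Finset.mem_range.1 hr)))

theorem measurable_smul_add_smul {α : Type*} {mα : MeasurableSpace α} {m n : ℕ}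
    {f g : α → BlockVec m n} (hf : Measurable f) (hg : Measurable g) (a b : ℝ) :
    Measurable (fun x => a • f x + b • g x) := by
  fun_prop

theorem measurable_add_smul_sub {α : Type*} {mα : MeasurableSpace α} {m n : ℕ}
    {f g h : α → BlockVec m n} (hf : Measurable f) (hg : Measurable g) (hh : Measurable h)
    (a : ℝ) : Measurable (fun x => f x + a • (g x - h x)) := by
  fun_prop

theorem measurable_block_extrapolation {α : Type*} {mα : MeasurableSpace α} {m n : ℕ}
    {f g h : α → BlockVec m n} (hf : Measurable f) (hg : Measurable g) (hh : Measurable h)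
    (p : Fin m) (s : Finset ℕ) (a : ℕ → ℝ) :
    Measurable (fun x => f x p + ∑ l ∈ s, a l • (g x p - h x p)) := by
  have hf := (measurable_block p).comp hf
  have hg := (measurable_block p).comp hg
  have hh := (measurable_block p).comp hh
  simp only [Function.comp_def] at hf hg hh
  fun_prop

theorem measurable_block_update {α : Type*} {mα : MeasurableSpace α} {m n : ℕ}
    {f g : α → BlockVec m n} {j : α → Fin m} (hf : Measurable f) (hg : Measurable g)
    (hj : Measurable j) (a : ℝ) (p : Fin m) :
    Measurable (fun x => if j x = p then f x p - a • g x p else f x p) := by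
  have hf := (measurable_block p).comp hf
  have hg := (measurable_block p).comp hg
  simp only [Function.comp_def] at hf hg
  exact Measurable.ite (hj (measurableSet_singleton p)) (by fun_prop) hf

theorem memLp_smul_add_smul {α : Type*} {mα : MeasurableSpace α} {μ : Measure α} {m n : ℕ}
    {f g : α → BlockVec m n} (hf : MemLp f 2 μ) (hg : MemLp g 2 μ) (a b : ℝ) :
    MemLp (fun x => a • f x + b • g x) 2 μ :=
  (hf.const_smul a).add (hg.const_smul b)

theorem memLp_add_smul {α : Type*} {mα : MeasurableSpace α} {μ : Measure α} {m n : ℕ}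
    {f g : α → BlockVec m n} (hf : MemLp f 2 μ) (hg : MemLp g 2 μ) (b : ℝ) :
    MemLp (fun x => f x + b • g x) 2 μ :=
  hf.add (hg.const_smul b)

theorem IsSmoothFun.continuous_gradient {m n : ℕ} {L : ℝ} {φ : BlockVec m n → ℝ}
    (hφ : IsSmoothFun L φ) : Continuous (gradient φ) := by
  refine (LipschitzWith.of_dist_le_mul (K := L.toNNReal) fun x y => ?_).continuous
  rw [dist_eq_norm, dist_eq_norm]
  exact (hφ.2 x y).trans (mul_le_mul_of_nonneg_right (Real.le_coe_toNNReal L) (norm_nonneg _))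

theorem IsSmoothFun.memLp_gradient {α : Type*} {mα : MeasurableSpace α} {μ : Measure α}
    [IsFiniteMeasure μ] {m n : ℕ} {L : ℝ} {φ : BlockVec m n → ℝ} (hφ : IsSmoothFun L φ)
    {f : α → BlockVec m n} (hf : MemLp f 2 μ) : MemLp (fun x => gradient φ (f x)) 2 μ := by
  have h1 : MemLp (fun x => gradient φ (f x) - gradient φ 0) 2 μ := by
    refine hf.of_le_mul (c := L)
      ((hφ.continuous_gradient.comp_aestronglyMeasurable hf.1).sub aestronglyMeasurable_const)
      (Filter.Eventually.of_forall fun x => ?_)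
    simpa using hφ.2 (f x) 0
  have e : (fun x => gradient φ (f x) - gradient φ 0) + (fun _ => gradient φ 0)
      = fun x => gradient φ (f x) := by
    funext x
    simp
  rw [← e]
  exact h1.add (memLp_const (gradient φ 0))

section

variable {Ω : Type u} {Ξ : Type v} [mΩ : MeasurableSpace Ω] [MeasurableSpace Ξ] {m n : ℕ}
  {P : Measure Ω} {ℱ : Filtration ℕ mΩ} {D : Measure Ξ}
  {φ : BlockVec m n → ℝ} {Φ : BlockVec m n → Ξ → ℝ} {γ : ℝ} {τ K : ℕ} {M : ℕ → ℕ}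
  {J : ℕ → Fin m → Ω → ℕ} {i : ℕ → Ω → Fin m} {ξ : ℕ → ℕ → Ω → Ξ} {x₀ : BlockVec m n}
  {lam zeta eta w : ℕ → Ω → BlockVec m n}

namespace IsRandomASBCDS

theorem measurable_lam_succ (h : IsRandomASBCDS P ℱ D Φ γ τ K M J i ξ x₀ lam zeta eta w)
    {k : ℕ} (hk : k < K) (hz : Measurable[ℱ k] (zeta k)) (he : Measurable[ℱ k] (eta k)) :
    Measurable[ℱ k] (lam (k + 1)) := by
  have e : lam (k + 1)
      = fun ω => theta m (k + 1) • zeta k ω + (1 - theta m (k + 1)) • eta k ω :=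
    funext fun ω => (h.run ω).lam_succ k hk
  rw [e]
  exact measurable_smul_add_smul hz he _ _

theorem measurable_w_succ (h : IsRandomASBCDS P ℱ D Φ γ τ K M J i ξ x₀ lam zeta eta w)
    {k : ℕ} (hk : k < K) (he : ∀ l ≤ k, Measurable[ℱ k] (eta l))
    (hl : ∀ l ≤ k, Measurable[ℱ k] (lam l)) :
    Measurable[ℱ k] (w (k + 1)) := by
  refine measurable_blockVec fun p => ?_
  -- The cut-off at `k` makes every `F j` measurable with respect to the past; later iterates need
  -- not be.
  let F : ℕ → Ω → EuclideanSpace ℝ (Fin n) := fun j ω => if j ≤ k then eta j ω p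
    + ∑ l ∈ Finset.Icc j k, rho m j l • (lam j ω p - eta (j - 1) ω p) else 0
  have e : (fun ω => w (k + 1) ω p) = fun ω => F (J (k + 1) p ω) ω := by
    funext ω
    simp only [F, if_pos (h.sampling.delay_le k hk p ω)]
    exact (h.run ω).w_succ k hk p
  rw [e]
  refine measurable_apply_countable (F := F) (fun j => ?_) (h.sampling.delay_measurable k hk p)
  by_cases hj : j ≤ k
  · simp only [F, if_pos hj]
    exact measurable_block_extrapolation (he j hj) (hl j hj) (he (j - 1) (by omega)) p _ _
  · simp only [F, if_neg hj]
    exact measurable_const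

theorem measurable_randGrad (h : IsRandomASBCDS P ℱ D Φ γ τ K M J i ξ x₀ lam zeta eta w)
    (hΦ : IsStochasticModel φ Φ D) {k : ℕ} (hk : k < K) (hw : Measurable[ℱ k] (w (k + 1))) :
    Measurable[ℱ (k + 1)] (randGrad Φ M ξ w (k + 1)) :=
  measurable_batchGrad hΦ (h.sampling.sample_measurable k hk) (hw.mono (ℱ.mono k.le_succ) le_rfl)

theorem measurable_zeta_succ (h : IsRandomASBCDS P ℱ D Φ γ τ K M J i ξ x₀ lam zeta eta w)
    {k : ℕ} (hk : k < K) (hz : Measurable[ℱ k] (zeta k))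
    (hg : Measurable[ℱ (k + 1)] (randGrad Φ M ξ w (k + 1))) :
    Measurable[ℱ (k + 1)] (zeta (k + 1)) := by
  refine measurable_blockVec fun p => ?_
  have e : (fun ω => zeta (k + 1) ω p) = fun ω => if i k ω = p then
      zeta k ω p - (γ / (m * theta m (k + 1))) • randGrad Φ M ξ w (k + 1) ω p
      else zeta k ω p := by
    funext ω
    split_ifs with hp
    · subst hp
      exact (h.run ω).zeta_succ_self k hk
    · exact (h.run ω).zeta_succ_other k hk p (Ne.symm hp)
  rw [e]
  exact measurable_block_update (hz.mono (ℱ.mono k.le_succ) le_rfl) hg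
    (h.sampling.block_measurable k hk) _ p

theorem measurable_eta_succ (h : IsRandomASBCDS P ℱ D Φ γ τ K M J i ξ x₀ lam zeta eta w)
    {k : ℕ} (hk : k < K) (hl : Measurable[ℱ k] (lam (k + 1))) (hz : Measurable[ℱ k] (zeta k))
    (hz' : Measurable[ℱ (k + 1)] (zeta (k + 1))) : Measurable[ℱ (k + 1)] (eta (k + 1)) := by
  have e : eta (k + 1)
      = fun ω => lam (k + 1) ω + (m * theta m (k + 1)) • (zeta (k + 1) ω - zeta k ω) :=
    funext fun ω => (h.run ω).eta_succ k hk
  rw [e]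
  exact measurable_add_smul_sub (hl.mono (ℱ.mono k.le_succ) le_rfl) hz'
    (hz.mono (ℱ.mono k.le_succ) le_rfl) _

theorem measurable_iterates (h : IsRandomASBCDS P ℱ D Φ γ τ K M J i ξ x₀ lam zeta eta w)
    (hΦ : IsStochasticModel φ Φ D) {k : ℕ} (hk : k ≤ K) :
    ∀ l ≤ k, Measurable[ℱ k] (eta l) ∧ Measurable[ℱ k] (zeta l) ∧ Measurable[ℱ k] (lam l) := by
  induction k with
  | zero =>
    intro l hl
    obtain rfl : l = 0 := by omega
    have e1 : eta 0 = fun _ => x₀ := funext fun ω => (h.run ω).eta_zero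
    have e2 : zeta 0 = fun _ => x₀ := funext fun ω => (h.run ω).zeta_zero
    have e3 : lam 0 = fun _ => x₀ := funext fun ω => (h.run ω).lam_zero
    rw [e1, e2, e3]
    exact ⟨measurable_const, measurable_const, measurable_const⟩
  | succ k ih =>
    have ih := ih (by omega)
    intro l hl
    rcases Nat.lt_or_ge k l with hlk | hlk
    · obtain rfl : l = k + 1 := by omega
      have hk : k < K := hk
      obtain ⟨h1, h2, -⟩ := ih k le_rfl
      have h3 := h.measurable_lam_succ hk h2 h1
      have h4 := h.measurable_w_succ hk (fun l hl => (ih l hl).1) (fun l hl => (ih l hl).2.2)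
      have h5 := h.measurable_zeta_succ hk h2 (h.measurable_randGrad hΦ hk h4)
      exact ⟨h.measurable_eta_succ hk h3 h2 h5, h5, h3.mono (ℱ.mono k.le_succ) le_rfl⟩
    · obtain ⟨h1, h2, h3⟩ := ih l hlk
      exact ⟨h1.mono (ℱ.mono k.le_succ) le_rfl, h2.mono (ℱ.mono k.le_succ) le_rfl,
        h3.mono (ℱ.mono k.le_succ) le_rfl⟩

theorem measurable_zeta (h : IsRandomASBCDS P ℱ D Φ γ τ K M J i ξ x₀ lam zeta eta w)
    (hΦ : IsStochasticModel φ Φ D) {k : ℕ} (hk : k ≤ K) : Measurable[ℱ k] (zeta k) :=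
  (h.measurable_iterates hΦ hk k le_rfl).2.1

theorem measurable_eta (h : IsRandomASBCDS P ℱ D Φ γ τ K M J i ξ x₀ lam zeta eta w)
    (hΦ : IsStochasticModel φ Φ D) {k : ℕ} (hk : k ≤ K) : Measurable[ℱ k] (eta k) :=
  (h.measurable_iterates hΦ hk k le_rfl).1

theorem measurable_lam (h : IsRandomASBCDS P ℱ D Φ γ τ K M J i ξ x₀ lam zeta eta w)
    (hΦ : IsStochasticModel φ Φ D) {k : ℕ} (hk : k < K) : Measurable[ℱ k] (lam (k + 1)) :=
  h.measurable_lam_succ hk (h.measurable_zeta hΦ hk.le) (h.measurable_eta hΦ hk.le)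

theorem measurable_w (h : IsRandomASBCDS P ℱ D Φ γ τ K M J i ξ x₀ lam zeta eta w)
    (hΦ : IsStochasticModel φ Φ D) {k : ℕ} (hk : k < K) : Measurable[ℱ k] (w (k + 1)) :=
  h.measurable_w_succ hk (fun l hl => (h.measurable_iterates hΦ hk.le l hl).1)
    (fun l hl => (h.measurable_iterates hΦ hk.le l hl).2.2)

variable [IsProbabilityMeasure P]

/-- Only the noise is assumed square integrable. Inductively, `w` inherits this from `lam` through
the pathwise delay bound, its gradient through the Lipschitz property, and the estimator as gradient
minus noise. -/
theorem memLp_iterates (h : IsRandomASBCDS P ℱ D Φ γ τ K M J i ξ x₀ lam zeta eta w)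
    (hm : 1 ≤ m) {L : ℝ} (hφ : IsSmoothFun L φ) (hΦ : IsStochasticModel φ Φ D)
    (hnoise : ∀ k < K, MemLp
      (fun ω => gradient φ (w (k + 1) ω) - randGrad Φ M ξ w (k + 1) ω) 2 P)
    {k : ℕ} (hk : k ≤ K) :
    ∀ l ≤ k, MemLp (eta l) 2 P ∧ MemLp (zeta l) 2 P ∧ MemLp (lam l) 2 P
      ∧ (1 ≤ l → MemLp (w l) 2 P ∧ MemLp (fun ω => gradient φ (w l ω)) 2 P
        ∧ MemLp (randGrad Φ M ξ w l) 2 P) := by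
  induction k with
  | zero =>
    intro l hl
    obtain rfl : l = 0 := by omega
    have e1 : eta 0 = fun _ => x₀ := funext fun ω => (h.run ω).eta_zero
    have e2 : zeta 0 = fun _ => x₀ := funext fun ω => (h.run ω).zeta_zero
    have e3 : lam 0 = fun _ => x₀ := funext fun ω => (h.run ω).lam_zero
    rw [e1, e2, e3]
    exact ⟨memLp_const _, memLp_const _, memLp_const _, by simp⟩
  | succ k ih =>
    have ih := ih (by omega)
    intro l hl
    rcases Nat.lt_or_ge k l with hlk | hlk
    swap
    · exact ih l hlk
    obtain rfl : l = k + 1 := by omega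
    have hk : k < K := hk
    obtain ⟨h1, h2, -⟩ := ih k le_rfl
    have hlam : MemLp (lam (k + 1)) 2 P := by
      have e : lam (k + 1)
          = fun ω => theta m (k + 1) • zeta k ω + (1 - theta m (k + 1)) • eta k ω :=
        funext fun ω => (h.run ω).lam_succ k hk
      rw [e]
      exact memLp_smul_add_smul h2 h1 _ _
    have hwm : Measurable (w (k + 1)) := (h.measurable_w hΦ hk).mono (ℱ.le k) le_rfl
    have hlm : Measurable (lam (k + 1)) := (h.measurable_lam hΦ hk).mono (ℱ.le k) le_rfl
    have hdiff : MemLp (fun ω => lam (k + 1) ω - w (k + 1) ω) 2 P := by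
      refine (memLp_two_iff_integrable_sq_norm (hlm.sub hwm).aestronglyMeasurable).2 ?_
      have hint : Integrable (fun ω => delaySum m τ * ∑ q ∈ Finset.range (k + 1),
          delayWeight m τ (k + 1 - q) * ‖eta q ω - lam q ω‖ ^ 2) P := by
        refine (integrable_finsetSum _ fun q hq => ?_).const_mul _
        have hq := ih q (Nat.lt_succ_iff.1 (Finset.mem_range.1 hq))
        exact ((hq.1.sub hq.2.2.1).integrable_norm_pow (by norm_num)).const_mul _
      refine hint.mono' ((hlm.sub hwm).norm.pow_const 2).aestronglyMeasurable
        (Filter.Eventually.of_forall fun ω => ?_)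
      rw [Real.norm_of_nonneg (by positivity)]
      exact (h.run ω).sq_norm_sub_compensated_le hm hk
        (fun p => h.sampling.delay_le k hk p ω) (fun p => h.sampling.le_delay_add k hk p ω)
    have hw : MemLp (w (k + 1)) 2 P := by
      have e : w (k + 1) = fun ω => lam (k + 1) ω - (lam (k + 1) ω - w (k + 1) ω) := by
        funext ω
        abel
      rw [e]
      exact hlam.sub hdiff
    have hgrad := hφ.memLp_gradient hw
    have hrand : MemLp (randGrad Φ M ξ w (k + 1)) 2 P := by
      have h3 := hgrad.sub (hnoise k hk)
      have e : (fun ω => gradient φ (w (k + 1) ω)) - (fun ω => gradient φ (w (k + 1) ω)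
          - randGrad Φ M ξ w (k + 1) ω) = randGrad Φ M ξ w (k + 1) := by
        funext ω
        simp
      rwa [e] at h3
    have hzm : Measurable (fun ω => zeta (k + 1) ω - zeta k ω) :=
      ((h.measurable_zeta hΦ (k := k + 1) hk).mono (ℱ.le _) le_rfl).sub
        ((h.measurable_zeta hΦ hk.le).mono (ℱ.le _) le_rfl)
    have hzd : MemLp (fun ω => zeta (k + 1) ω - zeta k ω) 2 P := by
      refine hrand.of_le_mul (c := |γ / (m * theta m (k + 1))|) hzm.aestronglyMeasurable
        (Filter.Eventually.of_forall fun ω => ?_)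
      refine le_of_sq_le_sq ?_ (by positivity)
      rw [(h.run ω).norm_sq_zeta_sub hk, mul_pow, sq_abs]
      gcongr
      exact PiLp.norm_apply_le (randGrad Φ M ξ w (k + 1) ω) (i k ω)
    have hz : MemLp (zeta (k + 1)) 2 P := by
      have h3 := hzd.add h2
      have e : (fun ω => zeta (k + 1) ω - zeta k ω) + zeta k = zeta (k + 1) := by
        funext ω
        simp
      rwa [e] at h3
    have he : MemLp (eta (k + 1)) 2 P := by
      have e : eta (k + 1)
          = fun ω => lam (k + 1) ω + (m * theta m (k + 1)) • (zeta (k + 1) ω - zeta k ω) :=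
        funext fun ω => (h.run ω).eta_succ k hk
      rw [e]
      exact memLp_add_smul hlam hzd _
    exact ⟨he, hz, hlam, fun _ => ⟨hw, hgrad, hrand⟩⟩

end IsRandomASBCDS

end

/-! ### Expectations along one iteration -/

theorem memLp_block {Ω : Type*} [MeasurableSpace Ω] {P : Measure Ω} {m n : ℕ}
    {f : Ω → BlockVec m n} (hf : MemLp f 2 P) (p : Fin m) : MemLp (fun ω => f ω p) 2 P :=
  hf.of_le ((PiLp.continuous_apply 2 _ p).comp_aestronglyMeasurable hf.1)
    (Filter.Eventually.of_forall fun ω => PiLp.norm_apply_le (f ω) p)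

theorem integrable_inner_of_memLp {Ω V : Type*} [MeasurableSpace Ω] {P : Measure Ω}
    [NormedAddCommGroup V] [InnerProductSpace ℝ V] {f g : Ω → V}
    (hf : MemLp f 2 P) (hg : MemLp g 2 P) : Integrable (fun ω => inner ℝ (f ω) (g ω)) P := by
  refine ((hf.integrable_norm_pow (by norm_num)).add (hg.integrable_norm_pow (by norm_num))).mono'
    (hf.1.inner hg.1) (Filter.Eventually.of_forall fun ω => ?_)
  have h1 := norm_inner_le_norm (𝕜 := ℝ) (f ω) (g ω)
  simp only [Pi.add_apply]
  nlinarith [sq_nonneg (‖f ω‖ - ‖g ω‖), sq_nonneg (‖f ω‖), sq_nonneg (‖g ω‖)]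

/-- Integrates a pathwise linear inequality between several integrable quantities in one stroke. -/
theorem sum_mul_integral_nonneg {Ω ι : Type*} [MeasurableSpace Ω] {P : Measure Ω} [Fintype ι]
    {f : ι → Ω → ℝ} (hf : ∀ j, Integrable (f j) P) (c : ι → ℝ) (h : ∀ ω, 0 ≤ ∑ j, c j * f j ω) :
    0 ≤ ∑ j, c j * ∫ ω, f j ω ∂P := by
  have : ∑ j, c j * ∫ ω, f j ω ∂P = ∫ ω, ∑ j, c j * f j ω ∂P := by
    rw [integral_finsetSum _ fun j _ => (hf j).const_mul (c j)]
    simp_rw [integral_const_mul]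
  rw [this]
  exact integral_nonneg h

theorem integrable_smooth_comp {Ω V : Type*} [MeasurableSpace Ω] {P : Measure Ω}
    [IsFiniteMeasure P] [NormedAddCommGroup V] [InnerProductSpace ℝ V] [CompleteSpace V]
    {φ : V → ℝ} {L : ℝ} (hd : Differentiable ℝ φ)
    (hL : ∀ x y, ‖gradient φ x - gradient φ y‖ ≤ L * ‖x - y‖)
    {u : V} (hu : IsMinOn φ Set.univ u) {f : Ω → V} (hf : MemLp f 2 P) :
    Integrable (fun ω => φ (f ω) - φ u) P := by
  have h1 : Integrable (fun ω => L / 2 * ‖f ω - u‖ ^ 2) P :=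
    ((hf.sub (memLp_const u)).integrable_norm_pow (by norm_num)).const_mul _
  refine h1.mono' ((hd.continuous.comp_aestronglyMeasurable hf.1).sub
    aestronglyMeasurable_const) (Filter.Eventually.of_forall fun ω => ?_)
  have h2 : φ u ≤ φ (f ω) := hu (Set.mem_univ _)
  have h3 := le_add_inner_gradient_add hd hL u (f ω)
  rw [hu.gradient_eq_zero, inner_zero_left] at h3
  rw [Real.norm_of_nonneg (by linarith)]
  linarith

section

variable {Ω : Type u} {Ξ : Type v} [mΩ : MeasurableSpace Ω] [MeasurableSpace Ξ] {m n : ℕ}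
  {P : Measure Ω} {ℱ : Filtration ℕ mΩ} {D : Measure Ξ}
  {φ : BlockVec m n → ℝ} {Φ : BlockVec m n → Ξ → ℝ} {γ : ℝ} {τ K : ℕ} {M : ℕ → ℕ}
  {J : ℕ → Fin m → Ω → ℕ} {i : ℕ → Ω → Fin m} {ξ : ℕ → ℕ → Ω → Ξ} {x₀ : BlockVec m n}
  {lam zeta eta w : ℕ → Ω → BlockVec m n}

namespace IsAsyncSampling

theorem measurable_block (h : IsAsyncSampling P ℱ D τ K M J i ξ) {k : ℕ} (hk : k < K) :
    Measurable (i k) :=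
  (h.block_measurable k hk).mono (ℱ.le _) le_rfl

theorem measurable_samples (h : IsAsyncSampling P ℱ D τ K M J i ξ) {k : ℕ} (hk : k < K) :
    Measurable (fun ω => fun r : Fin (M (k + 1)) => ξ (k + 1) r ω) :=
  measurable_pi_iff.2 fun r => (h.sample_measurable k hk r r.2).mono (ℱ.le _) le_rfl

theorem indepFun_past (h : IsAsyncSampling P ℱ D τ K M J i ξ) {k : ℕ} (hk : k < K)
    {S : Type*} [MeasurableSpace S] {H : Ω → S} (hH : Measurable[ℱ k] H) :
    IndepFun (fun ω => (i k ω, fun r : Fin (M (k + 1)) => ξ (k + 1) r ω)) H P :=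
  (IndepFun_iff_Indep _ _ _).2 (indep_of_indep_of_le_right (h.indep k hk) hH.comap_le)

theorem indepFun_samples_past (h : IsAsyncSampling P ℱ D τ K M J i ξ) {k : ℕ} (hk : k < K)
    {S : Type*} [MeasurableSpace S] {H : Ω → S} (hH : Measurable[ℱ k] H) :
    IndepFun (fun ω => fun r : Fin (M (k + 1)) => ξ (k + 1) r ω) H P :=
  (h.indepFun_past hk hH).comp measurable_snd measurable_id

theorem isProbabilityMeasure_uniform (hm : 1 ≤ m) :
    IsProbabilityMeasure (uniformOn (Set.univ : Set (Fin m))) := by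
  have : NeZero m := ⟨by omega⟩
  exact isProbabilityMeasure_uniformOn Set.finite_univ Set.univ_nonempty

variable [IsProbabilityMeasure D]

theorem map_block (h : IsAsyncSampling P ℱ D τ K M J i ξ) {k : ℕ} (hk : k < K) :
    P.map (i k) = uniformOn (Set.univ : Set (Fin m)) := by
  have := congrArg (Measure.map Prod.fst) (h.law k hk)
  rwa [Measure.map_map measurable_fst ((h.measurable_block hk).prodMk (h.measurable_samples hk)),
    Measure.map_fst_prod, measure_univ, one_smul] at this

theorem map_samples (h : IsAsyncSampling P ℱ D τ K M J i ξ) (hm : 1 ≤ m) {k : ℕ} (hk : k < K) :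
    P.map (fun ω => fun r : Fin (M (k + 1)) => ξ (k + 1) r ω) = Measure.pi fun _ => D := by
  have := isProbabilityMeasure_uniform hm
  have := congrArg (Measure.map Prod.snd) (h.law k hk)
  rwa [Measure.map_map measurable_snd ((h.measurable_block hk).prodMk (h.measurable_samples hk)),
    Measure.map_snd_prod, measure_univ, one_smul] at this

variable [IsProbabilityMeasure P]

theorem indepFun_block (h : IsAsyncSampling P ℱ D τ K M J i ξ) (hm : 1 ≤ m) {k : ℕ} (hk : k < K)
    {S : Type*} [MeasurableSpace S] {H : Ω → S} (hH : Measurable[ℱ k] H) :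
    IndepFun (i k) (fun ω => ((fun r : Fin (M (k + 1)) => ξ (k + 1) r ω), H ω)) P :=
  have := isProbabilityMeasure_uniform hm
  indepFun_prodMk_of_map_prod (h.measurable_block hk) (h.measurable_samples hk)
    (hH.mono (ℱ.le k) le_rfl) (h.law k hk) (h.indepFun_past hk hH)

end IsAsyncSampling

namespace IsRandomASBCDS

variable [IsProbabilityMeasure P] [IsProbabilityMeasure D]

theorem integral_inner_randGrad (h : IsRandomASBCDS P ℱ D Φ γ τ K M J i ξ x₀ lam zeta eta w)
    (hm : 1 ≤ m) (hM : ∀ k, 1 ≤ M k) (hΦ : IsStochasticModel φ Φ D) {k : ℕ} (hk : k < K)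
    {X : Ω → BlockVec m n} (hX : Measurable[ℱ k] X) (hX2 : MemLp X 2 P)
    (hR2 : MemLp (randGrad Φ M ξ w (k + 1)) 2 P) :
    ∫ ω, inner ℝ (X ω) (randGrad Φ M ξ w (k + 1) ω) ∂P
      = ∫ ω, inner ℝ (X ω) (gradient φ (w (k + 1) ω)) ∂P := by
  have hint := integrable_inner_of_memLp hX2 hR2
  simp only [randGrad, batchGrad_eq_finBatchGrad] at hint ⊢
  have hw := h.measurable_w hΦ hk
  exact hΦ.integral_inner_finBatchGrad (hM (k + 1)) (h.sampling.measurable_samples hk)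
    (hX.mono (ℱ.le k) le_rfl) (hw.mono (ℱ.le k) le_rfl) (h.sampling.map_samples hm hk)
    (h.sampling.indepFun_samples_past hk (hX.prodMk hw)) hint

/-- The block is independent of the samples and the past jointly, so averaging over it first gives
`1/m` of the full inner product; unbiasedness then replaces the estimator by the gradient. -/
theorem integral_inner_block_randGrad
    (h : IsRandomASBCDS P ℱ D Φ γ τ K M J i ξ x₀ lam zeta eta w)
    (hm : 1 ≤ m) (hM : ∀ k, 1 ≤ M k) (hΦ : IsStochasticModel φ Φ D) {k : ℕ} (hk : k < K)
    {X : Ω → BlockVec m n} (hX : Measurable[ℱ k] X) (hX2 : MemLp X 2 P)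
    (hR2 : MemLp (randGrad Φ M ξ w (k + 1)) 2 P) :
    ∫ ω, inner ℝ (X ω (i k ω)) (randGrad Φ M ξ w (k + 1) ω (i k ω)) ∂P
      = 1 / m * ∫ ω, inner ℝ (X ω) (gradient φ (w (k + 1) ω)) ∂P := by
  rw [← h.integral_inner_randGrad hm hM hΦ hk hX hX2 hR2]
  have hw := h.measurable_w hΦ hk
  have hint : ∀ p, Integrable
      (fun ω => inner ℝ (X ω p) (randGrad Φ M ξ w (k + 1) ω p)) P := fun p =>
    integrable_inner_of_memLp (memLp_block hX2 p) (memLp_block hR2 p)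
  have e : ∫ ω, inner ℝ (X ω) (randGrad Φ M ξ w (k + 1) ω) ∂P
      = ∑ p, ∫ ω, inner ℝ (X ω p) (randGrad Φ M ξ w (k + 1) ω p) ∂P := by
    rw [← integral_finsetSum _ fun p _ => hint p]
    rfl
  rw [e]
  simp only [randGrad, batchGrad_eq_finBatchGrad] at hint ⊢
  have hXw := hX.prodMk hw
  let F : Fin m → (Fin (M (k + 1)) → Ξ) × (BlockVec m n × BlockVec m n) → ℝ := fun p q =>
    inner ℝ (q.2.1 p) (finBatchGrad Φ (M (k + 1)) q.1 q.2.2 p)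
  have hB : Measurable (fun q : (Fin (M (k + 1)) → Ξ) × (BlockVec m n × BlockVec m n) =>
      finBatchGrad Φ (M (k + 1)) q.1 q.2.2) :=
    Measurable.comp
      (f := fun q : (Fin (M (k + 1)) → Ξ) × (BlockVec m n × BlockVec m n) => (q.1, q.2.2))
      (hΦ.measurable_finBatchGrad (M (k + 1)))
      (measurable_fst.prodMk (measurable_snd.comp measurable_snd))
  have hX' : Measurable (fun q : (Fin (M (k + 1)) → Ξ) × (BlockVec m n × BlockVec m n) =>
    q.2.1) := measurable_fst.comp measurable_snd
  have hF : ∀ p, Measurable (F p) := fun p =>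
    ((measurable_block p).comp hX').inner ((measurable_block p).comp hB)
  exact IndepFun.integral_apply_uniform (F := F) (h.sampling.measurable_block hk)
    ((h.sampling.measurable_samples hk).prodMk (hXw.mono (ℱ.le k) le_rfl))
    (h.sampling.map_block hk) (h.sampling.indepFun_block hm hk hXw) hF hint

theorem integral_norm_sq_block_randGrad
    (h : IsRandomASBCDS P ℱ D Φ γ τ K M J i ξ x₀ lam zeta eta w)
    (hm : 1 ≤ m) (hΦ : IsStochasticModel φ Φ D) {k : ℕ} (hk : k < K)
    (hR2 : MemLp (randGrad Φ M ξ w (k + 1)) 2 P) :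
    ∫ ω, ‖randGrad Φ M ξ w (k + 1) ω (i k ω)‖ ^ 2 ∂P
      = 1 / m * ∫ ω, ‖randGrad Φ M ξ w (k + 1) ω‖ ^ 2 ∂P := by
  have hw := h.measurable_w hΦ hk
  have hint : ∀ p, Integrable (fun ω => ‖randGrad Φ M ξ w (k + 1) ω p‖ ^ 2) P := fun p =>
    (memLp_block hR2 p).integrable_norm_pow (by norm_num)
  have e : ∫ ω, ‖randGrad Φ M ξ w (k + 1) ω‖ ^ 2 ∂P
      = ∑ p, ∫ ω, ‖randGrad Φ M ξ w (k + 1) ω p‖ ^ 2 ∂P := by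
    rw [← integral_finsetSum _ fun p _ => hint p]
    simp_rw [PiLp.norm_sq_eq_of_L2]
  rw [e]
  simp only [randGrad, batchGrad_eq_finBatchGrad] at hint ⊢
  let F : Fin m → (Fin (M (k + 1)) → Ξ) × BlockVec m n → ℝ := fun p q =>
    ‖finBatchGrad Φ (M (k + 1)) q.1 q.2 p‖ ^ 2
  have hF : ∀ p, Measurable (F p) := fun p =>
    ((measurable_block p).comp (hΦ.measurable_finBatchGrad (M (k + 1)))).norm.pow_const 2
  exact IndepFun.integral_apply_uniform (F := F) (h.sampling.measurable_block hk)
    ((h.sampling.measurable_samples hk).prodMk (hw.mono (ℱ.le k) le_rfl))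
    (h.sampling.map_block hk) (h.sampling.indepFun_block hm hk hw) hF hint

/-- Bias–variance decomposition. It trades the gain in `∇φ(ω)` for one in the second moment of the
estimator, the quantity in which the delay error is expressed. -/
theorem integral_norm_sq_randGrad
    (h : IsRandomASBCDS P ℱ D Φ γ τ K M J i ξ x₀ lam zeta eta w)
    (hm : 1 ≤ m) (hM : ∀ k, 1 ≤ M k) {L : ℝ} (hφ : IsSmoothFun L φ)
    (hΦ : IsStochasticModel φ Φ D) {k : ℕ} (hk : k < K)
    (hg2 : MemLp (fun ω => gradient φ (w (k + 1) ω)) 2 P)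
    (hR2 : MemLp (randGrad Φ M ξ w (k + 1)) 2 P) :
    ∫ ω, ‖gradient φ (w (k + 1) ω)‖ ^ 2 ∂P = ∫ ω, ‖randGrad Φ M ξ w (k + 1) ω‖ ^ 2 ∂P
      - ∫ ω, ‖gradient φ (w (k + 1) ω) - randGrad Φ M ξ w (k + 1) ω‖ ^ 2 ∂P := by
  have h1 := h.integral_inner_randGrad hm hM hΦ hk
    (hφ.continuous_gradient.measurable.comp (h.measurable_w hΦ hk)) hg2 hR2
  simp only [Function.comp_apply, real_inner_self_eq_norm_sq] at h1
  have i1 := hg2.integrable_norm_pow (p := 2) (by norm_num)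
  have i2 := hR2.integrable_norm_pow (p := 2) (by norm_num)
  have i3 := (integrable_inner_of_memLp hg2 hR2).const_mul 2
  simp only [norm_sub_sq_real]
  have i4 : Integrable (fun ω => ‖gradient φ (w (k + 1) ω)‖ ^ 2
      - 2 * inner ℝ (gradient φ (w (k + 1) ω)) (randGrad Φ M ξ w (k + 1) ω)) P := i1.sub i3
  rw [integral_add i4 i2, integral_sub i1 i3, integral_const_mul, h1]
  ring

end IsRandomASBCDS

end

/-! ### The recursion for the expected potential -/

section

variable {Ω : Type u} {Ξ : Type v} [mΩ : MeasurableSpace Ω] [MeasurableSpace Ξ] {m n : ℕ}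
  {P : Measure Ω} {ℱ : Filtration ℕ mΩ} {D : Measure Ξ}
  {φ : BlockVec m n → ℝ} {Φ : BlockVec m n → Ξ → ℝ} {γ : ℝ} {τ K : ℕ} {M : ℕ → ℕ}
  {J : ℕ → Fin m → Ω → ℕ} {i : ℕ → Ω → Fin m} {ξ : ℕ → ℕ → Ω → Ξ} {x₀ : BlockVec m n}
  {lam zeta eta w : ℕ → Ω → BlockVec m n} [IsProbabilityMeasure P] [IsProbabilityMeasure D]

namespace IsRandomASBCDS

theorem integral_potential_succ_le (h : IsRandomASBCDS P ℱ D Φ γ τ K M J i ξ x₀ lam zeta eta w)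
    (hm : 1 ≤ m) (hM : ∀ k, 1 ≤ M k) (hγ : 0 < γ) {L : ℝ} (hφ : IsSmoothFun L φ)
    (hΦ : IsStochasticModel φ Φ D) {u : BlockVec m n} (hu : IsMinOn φ Set.univ u)
    (hnoise : ∀ k < K, MemLp
      (fun ω => gradient φ (w (k + 1) ω) - randGrad Φ M ξ w (k + 1) ω) 2 P)
    {k : ℕ} (hk : k < K) :
    invTheta m (k + 1) ^ 2 * ∫ ω, (φ (eta (k + 1) ω) - φ u) ∂P
        + m ^ 2 / (2 * γ) * ∫ ω, ‖zeta (k + 1) ω - u‖ ^ 2 ∂P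
      ≤ invTheta m (k + 1) ^ 2 * ∫ ω, (φ (lam (k + 1) ω) - φ u) ∂P
        + m ^ 2 / (2 * γ) * ∫ ω, ‖zeta k ω - u‖ ^ 2 ∂P
        - 1 / m * ∫ ω, inner ℝ ((invTheta m (k + 1) ^ 2 * γ) • gradient φ (lam (k + 1) ω)
            + (invTheta m (k + 1) * m) • (zeta k ω - u)) (gradient φ (w (k + 1) ω)) ∂P
        + invTheta m (k + 1) ^ 2 * (γ / 2) * (1 + L * γ)
          * (1 / m * ∫ ω, ‖randGrad Φ M ξ w (k + 1) ω‖ ^ 2 ∂P) := by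
  have hmem := h.memLp_iterates hm hφ hΦ hnoise (k := k + 1) hk
  obtain ⟨he', hz', hl, hwgr⟩ := hmem (k + 1) le_rfl
  obtain ⟨-, hg, hR⟩ := hwgr (by omega)
  obtain ⟨he, hz, -, -⟩ := hmem k (by omega)
  have hlm := h.measurable_lam hΦ hk
  have hzm := h.measurable_zeta hΦ hk.le
  let X : Ω → BlockVec m n := fun ω => (invTheta m (k + 1) ^ 2 * γ) • gradient φ (lam (k + 1) ω)
    + (invTheta m (k + 1) * m) • (zeta k ω - u)
  have hXm : Measurable[ℱ k] X :=
    measurable_smul_add_smul (hφ.continuous_gradient.measurable.comp hlm)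
      (hzm.sub_const u) _ _
  have hgl : MemLp (fun ω => gradient φ (lam (k + 1) ω)) 2 P := hφ.memLp_gradient hl
  have hX : MemLp X 2 P := memLp_smul_add_smul hgl (hz.sub (memLp_const u)) _ _
  have e1 := h.integral_inner_block_randGrad hm hM hΦ hk hXm hX hR
  have e2 := h.integral_norm_sq_block_randGrad hm hΦ hk hR
  rw [← e1, ← e2]
  have hRm : Measurable (randGrad Φ M ξ w (k + 1)) :=
    (h.measurable_randGrad hΦ hk (h.measurable_w hΦ hk)).mono (ℱ.le _) le_rfl
  have hRi : MemLp (fun ω => randGrad Φ M ξ w (k + 1) ω (i k ω)) 2 P := by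
    refine hR.of_le ?_ (Filter.Eventually.of_forall fun ω => PiLp.norm_apply_le _ _)
    exact (measurable_apply_countable (F := fun p ω => randGrad Φ M ξ w (k + 1) ω p)
      (fun p => (measurable_block p).comp hRm)
      (h.sampling.measurable_block hk)).aestronglyMeasurable
  have hXi : MemLp (fun ω => X ω (i k ω)) 2 P := by
    refine hX.of_le ?_ (Filter.Eventually.of_forall fun ω => PiLp.norm_apply_le _ _)
    exact (measurable_apply_countable (F := fun p ω => X ω p)
      (fun p => (measurable_block p).comp (hXm.mono (ℱ.le _) le_rfl))
      (h.sampling.measurable_block hk)).aestronglyMeasurable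
  have key := sum_mul_integral_nonneg (P := P)
    (f := ![fun ω => φ (eta (k + 1) ω) - φ u, fun ω => ‖zeta (k + 1) ω - u‖ ^ 2,
      fun ω => φ (lam (k + 1) ω) - φ u, fun ω => ‖zeta k ω - u‖ ^ 2,
      fun ω => inner ℝ (X ω (i k ω)) (randGrad Φ M ξ w (k + 1) ω (i k ω)),
      fun ω => ‖randGrad Φ M ξ w (k + 1) ω (i k ω)‖ ^ 2])
    (by
      simp only [Fin.forall_fin_succ, IsEmpty.forall_iff, and_true]
      exact ⟨integrable_smooth_comp hφ.1 hφ.2 hu he',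
        (hz'.sub (memLp_const u)).integrable_norm_pow (by norm_num),
        integrable_smooth_comp hφ.1 hφ.2 hu hl,
        (hz.sub (memLp_const u)).integrable_norm_pow (by norm_num),
        integrable_inner_of_memLp hXi hRi, hRi.integrable_norm_pow (by norm_num)⟩)
    ![-invTheta m (k + 1) ^ 2, -(m ^ 2 / (2 * γ)), invTheta m (k + 1) ^ 2, m ^ 2 / (2 * γ), -1,
      invTheta m (k + 1) ^ 2 * (γ / 2) * (1 + L * γ)]
    (by
      intro ω
      rw [Fin.sum_univ_six]
      have := (h.run ω).potential_succ_le hm hγ hφ u hk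
      change 0 ≤ -invTheta m (k + 1) ^ 2 * (φ (eta (k + 1) ω) - φ u)
        + -(m ^ 2 / (2 * γ)) * ‖zeta (k + 1) ω - u‖ ^ 2
        + invTheta m (k + 1) ^ 2 * (φ (lam (k + 1) ω) - φ u)
        + m ^ 2 / (2 * γ) * ‖zeta k ω - u‖ ^ 2
        + -1 * inner ℝ (X ω (i k ω)) (randGrad Φ M ξ w (k + 1) ω (i k ω))
        + invTheta m (k + 1) ^ 2 * (γ / 2) * (1 + L * γ)
          * ‖randGrad Φ M ξ w (k + 1) ω (i k ω)‖ ^ 2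
      simp only [X, randGrad]
      linarith)
  rw [Fin.sum_univ_six] at key
  change 0 ≤ -invTheta m (k + 1) ^ 2 * ∫ ω, (φ (eta (k + 1) ω) - φ u) ∂P
    + -(m ^ 2 / (2 * γ)) * ∫ ω, ‖zeta (k + 1) ω - u‖ ^ 2 ∂P
    + invTheta m (k + 1) ^ 2 * ∫ ω, (φ (lam (k + 1) ω) - φ u) ∂P
    + m ^ 2 / (2 * γ) * ∫ ω, ‖zeta k ω - u‖ ^ 2 ∂P
    + -1 * ∫ ω, inner ℝ (X ω (i k ω)) (randGrad Φ M ξ w (k + 1) ω (i k ω)) ∂P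
    + invTheta m (k + 1) ^ 2 * (γ / 2) * (1 + L * γ)
      * ∫ ω, ‖randGrad Φ M ξ w (k + 1) ω (i k ω)‖ ^ 2 ∂P at key
  linarith

theorem integral_model_le (h : IsRandomASBCDS P ℱ D Φ γ τ K M J i ξ x₀ lam zeta eta w)
    (hm : 1 ≤ m) (hM : ∀ k, 1 ≤ M k) (hγ : 0 < γ) {L : ℝ} (hc : ConvexOn ℝ Set.univ φ)
    (hφ : IsSmoothFun L φ)
    (hΦ : IsStochasticModel φ Φ D) {u : BlockVec m n} (hu : IsMinOn φ Set.univ u)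
    (hnoise : ∀ k < K, MemLp
      (fun ω => gradient φ (w (k + 1) ω) - randGrad Φ M ξ w (k + 1) ω) 2 P)
    {k : ℕ} (hk : k < K) :
    invTheta m (k + 1) ^ 2 * ∫ ω, (φ (lam (k + 1) ω) - φ u) ∂P
        - 1 / m * ∫ ω, inner ℝ ((invTheta m (k + 1) ^ 2 * γ) • gradient φ (lam (k + 1) ω)
            + (invTheta m (k + 1) * m) • (zeta k ω - u)) (gradient φ (w (k + 1) ω)) ∂P
      ≤ (invTheta m (k + 1) ^ 2 - invTheta m (k + 1)) * ∫ ω, (φ (eta k ω) - φ u) ∂P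
        + invTheta m (k + 1) ^ 2 * (L / 2 + 2 * L ^ 2 * γ / m)
          * ∫ ω, ‖lam (k + 1) ω - w (k + 1) ω‖ ^ 2 ∂P
        - 7 / 8 * (invTheta m (k + 1) ^ 2 * γ / m)
          * (∫ ω, ‖randGrad Φ M ξ w (k + 1) ω‖ ^ 2 ∂P
            - ∫ ω, ‖gradient φ (w (k + 1) ω) - randGrad Φ M ξ w (k + 1) ω‖ ^ 2 ∂P) := by
  have hmem := h.memLp_iterates hm hφ hΦ hnoise (k := k + 1) hk
  obtain ⟨-, -, hl, hwgr⟩ := hmem (k + 1) le_rfl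
  obtain ⟨hw, hg, hR⟩ := hwgr (by omega)
  obtain ⟨he, hz, -, -⟩ := hmem k (by omega)
  have hX := memLp_smul_add_smul (hφ.memLp_gradient hl) (hz.sub (memLp_const u))
    (invTheta m (k + 1) ^ 2 * γ) (invTheta m (k + 1) * m)
  rw [← h.integral_norm_sq_randGrad hm hM hφ hΦ hk hg hR]
  have key := sum_mul_integral_nonneg (P := P)
    (f := ![fun ω => φ (lam (k + 1) ω) - φ u,
      fun ω => inner ℝ ((invTheta m (k + 1) ^ 2 * γ) • gradient φ (lam (k + 1) ω)
            + (invTheta m (k + 1) * m) • (zeta k ω - u)) (gradient φ (w (k + 1) ω)),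
      fun ω => φ (eta k ω) - φ u, fun ω => ‖lam (k + 1) ω - w (k + 1) ω‖ ^ 2,
      fun ω => ‖gradient φ (w (k + 1) ω)‖ ^ 2])
    (by
      simp only [Fin.forall_fin_succ, IsEmpty.forall_iff, and_true]
      exact ⟨integrable_smooth_comp hφ.1 hφ.2 hu hl, integrable_inner_of_memLp hX hg,
        integrable_smooth_comp hφ.1 hφ.2 hu he,
        (hl.sub hw).integrable_norm_pow (by norm_num), hg.integrable_norm_pow (by norm_num)⟩)
    ![-invTheta m (k + 1) ^ 2, 1 / m, invTheta m (k + 1) ^ 2 - invTheta m (k + 1),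
      invTheta m (k + 1) ^ 2 * (L / 2 + 2 * L ^ 2 * γ / m),
      -(7 / 8 * (invTheta m (k + 1) ^ 2 * γ / m))]
    (by
      intro ω
      rw [Fin.sum_univ_five]
      have := (h.run ω).model_le hm hγ hc hφ u hk
      change 0 ≤ -invTheta m (k + 1) ^ 2 * (φ (lam (k + 1) ω) - φ u)
        + 1 / m * inner ℝ ((invTheta m (k + 1) ^ 2 * γ) • gradient φ (lam (k + 1) ω)
            + (invTheta m (k + 1) * m) • (zeta k ω - u)) (gradient φ (w (k + 1) ω))
        + (invTheta m (k + 1) ^ 2 - invTheta m (k + 1)) * (φ (eta k ω) - φ u)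
        + invTheta m (k + 1) ^ 2 * (L / 2 + 2 * L ^ 2 * γ / m)
          * ‖lam (k + 1) ω - w (k + 1) ω‖ ^ 2
        + -(7 / 8 * (invTheta m (k + 1) ^ 2 * γ / m)) * ‖gradient φ (w (k + 1) ω)‖ ^ 2
      linarith)
  rw [Fin.sum_univ_five] at key
  change 0 ≤ -invTheta m (k + 1) ^ 2 * ∫ ω, (φ (lam (k + 1) ω) - φ u) ∂P
    + 1 / m * ∫ ω, inner ℝ ((invTheta m (k + 1) ^ 2 * γ) • gradient φ (lam (k + 1) ω)
            + (invTheta m (k + 1) * m) • (zeta k ω - u)) (gradient φ (w (k + 1) ω)) ∂P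
    + (invTheta m (k + 1) ^ 2 - invTheta m (k + 1)) * ∫ ω, (φ (eta k ω) - φ u) ∂P
    + invTheta m (k + 1) ^ 2 * (L / 2 + 2 * L ^ 2 * γ / m)
      * ∫ ω, ‖lam (k + 1) ω - w (k + 1) ω‖ ^ 2 ∂P
    + -(7 / 8 * (invTheta m (k + 1) ^ 2 * γ / m))
      * ∫ ω, ‖gradient φ (w (k + 1) ω)‖ ^ 2 ∂P at key
  linarith

theorem integral_norm_sq_eta_sub
    (h : IsRandomASBCDS P ℱ D Φ γ τ K M J i ξ x₀ lam zeta eta w)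
    (hm : 1 ≤ m) (hΦ : IsStochasticModel φ Φ D) {k : ℕ} (hk : k < K)
    (hR2 : MemLp (randGrad Φ M ξ w (k + 1)) 2 P) :
    ∫ ω, ‖eta (k + 1) ω - lam (k + 1) ω‖ ^ 2 ∂P
      = γ ^ 2 / m * ∫ ω, ‖randGrad Φ M ξ w (k + 1) ω‖ ^ 2 ∂P := by
  have e : ∀ ω, ‖eta (k + 1) ω - lam (k + 1) ω‖ ^ 2
      = γ ^ 2 * ‖randGrad Φ M ξ w (k + 1) ω (i k ω)‖ ^ 2 := fun ω =>
    (h.run ω).norm_sq_eta_sub hm hk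
  simp_rw [e]
  rw [integral_const_mul, h.integral_norm_sq_block_randGrad hm hΦ hk hR2]
  ring

theorem integral_norm_sq_sub_compensated_le
    (h : IsRandomASBCDS P ℱ D Φ γ τ K M J i ξ x₀ lam zeta eta w)
    (hm : 1 ≤ m) {L : ℝ} (hφ : IsSmoothFun L φ) (hΦ : IsStochasticModel φ Φ D)
    (hnoise : ∀ k < K, MemLp
      (fun ω => gradient φ (w (k + 1) ω) - randGrad Φ M ξ w (k + 1) ω) 2 P)
    {k : ℕ} (hk : k < K) :
    ∫ ω, ‖lam (k + 1) ω - w (k + 1) ω‖ ^ 2 ∂P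
      ≤ delaySum m τ * (γ ^ 2 / m * ∑ q ∈ Finset.range k, delayWeight m τ (k - q)
          * ∫ ω, ‖randGrad Φ M ξ w (q + 1) ω‖ ^ 2 ∂P) := by
  have hmem := h.memLp_iterates hm hφ hΦ hnoise (k := k + 1) hk
  have hint : ∀ q ∈ Finset.range (k + 1), Integrable
      (fun ω => delayWeight m τ (k + 1 - q) * ‖eta q ω - lam q ω‖ ^ 2) P := fun q hq => by
    obtain ⟨h1, -, h3, -⟩ := hmem q (by have := Finset.mem_range.1 hq; omega)
    exact ((h1.sub h3).integrable_norm_pow (by norm_num)).const_mul _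
  have h1 : ∫ ω, ‖lam (k + 1) ω - w (k + 1) ω‖ ^ 2 ∂P
      ≤ ∫ ω, delaySum m τ * ∑ q ∈ Finset.range (k + 1),
          delayWeight m τ (k + 1 - q) * ‖eta q ω - lam q ω‖ ^ 2 ∂P := by
    refine integral_mono_of_nonneg (Filter.Eventually.of_forall fun ω => sq_nonneg _)
      ((integrable_finsetSum _ hint).const_mul _) (Filter.Eventually.of_forall fun ω => ?_)
    exact (h.run ω).sq_norm_sub_compensated_le hm hk
        (fun p => h.sampling.delay_le k hk p ω) (fun p => h.sampling.le_delay_add k hk p ω)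
  refine h1.trans (le_of_eq ?_)
  rw [integral_const_mul, integral_finsetSum _ hint, Finset.sum_range_succ', Finset.mul_sum]
  simp_rw [integral_const_mul]
  -- The term `q = 0` vanishes; the shift of the others turns the lag `k + 1 - q` into `k - q`.
  have e0 : ∀ ω, eta 0 ω - lam 0 ω = 0 := fun ω => by
    rw [(h.run ω).eta_zero, (h.run ω).lam_zero, sub_self]
  simp only [e0, norm_zero]
  congr 1
  rw [zero_pow (by norm_num), integral_zero, mul_zero, add_zero]
  refine Finset.sum_congr rfl fun q hq => ?_
  have hq := Finset.mem_range.1 hq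
  obtain ⟨-, -, hR⟩ := (hmem (q + 1) (by omega)).2.2.2 (by omega)
  rw [h.integral_norm_sq_eta_sub hm hΦ (by omega) hR, Nat.add_sub_add_right]
  ring

end IsRandomASBCDS

end

/-! ### Summation of the recursion -/

/-- After exchanging the sums, a weight is nonzero only for lags up to `τ + 1 ≤ m + 1`, where the
reciprocals grow at most by `9/4`; `81/16` is its square. -/
theorem sum_sq_invTheta_mul_delay_le {m τ : ℕ} (hm : 1 ≤ m) (hτ : τ ≤ m) {b : ℕ → ℝ}
    (hb : ∀ k, 0 ≤ b k) (K : ℕ) :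
    ∑ k ∈ Finset.range K, invTheta m (k + 1) ^ 2
        * ∑ q ∈ Finset.range k, delayWeight m τ (k - q) * b q
      ≤ 81 / 16 * delaySum m τ * ∑ q ∈ Finset.range K, invTheta m (q + 1) ^ 2 * b q := by
  simp_rw [Finset.mul_sum]
  rw [Finset.sum_comm' (s' := fun q => Finset.Ico (q + 1) K) (t' := Finset.range K)
    (by intro k q; simp only [Finset.mem_range, Finset.mem_Ico]; omega)]
  refine Finset.sum_le_sum fun q _ => ?_
  have h1 : ∑ k ∈ Finset.Ico (q + 1) K, delayWeight m τ (k - q) ≤ delaySum m τ := by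
    have e : ∑ k ∈ Finset.Ico (q + 1) K, delayWeight m τ (k - q)
        = ∑ r ∈ Finset.Icc 1 (K - 1 - q), delayWeight m τ r := by
      refine Finset.sum_nbij' (fun k => k - q) (fun r => r + q) ?_ ?_ ?_ ?_ ?_ <;>
        intro q hq <;> simp only [Finset.mem_Ico, Finset.mem_Icc] at * <;> omega
    rw [e]
    exact sum_Icc_delayWeight_le m τ _
  have h2 : ∀ k ∈ Finset.Ico (q + 1) K,
      invTheta m (k + 1) ^ 2 * (delayWeight m τ (k - q) * b q)
        ≤ 81 / 16 * (invTheta m (q + 1) ^ 2 * b q) * delayWeight m τ (k - q) := by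
    intro k hk
    have hk := Finset.mem_Ico.1 hk
    by_cases hr : k - q ≤ τ + 1
    · have h3 := invTheta_add_le_mul hm q (k - q) (by omega)
      rw [show q + 1 + (k - q) = k + 1 by omega] at h3
      have h4 := pow_le_pow_left₀ (invTheta_pos hm (k + 1)).le h3 2
      have h5 := mul_nonneg (delayWeight_nonneg m τ (k - q)) (hb q)
      nlinarith [mul_le_mul_of_nonneg_right h4 h5]
    · rw [delayWeight, if_neg hr]
      simp
  refine (Finset.sum_le_sum h2).trans ?_
  rw [← Finset.mul_sum]
  have h3 : 0 ≤ invTheta m (q + 1) ^ 2 * b q := mul_nonneg (sq_nonneg _) (hb q)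
  nlinarith [mul_le_mul_of_nonneg_left h1 h3]

/-- The step size condition makes the delay error smaller than the progress of an iteration. -/
theorem delay_error_le {m τ : ℕ} {L γ : ℝ} (hm : 1 ≤ m) (hτ : 1 ≤ τ) (hL : 0 < L) (hγ : 0 < γ)
    (hstep : stepQuantity m τ L γ ≤ 1) :
    (L / 2 + 2 * L ^ 2 * γ / m) * delaySum m τ * (γ ^ 2 / m) * (81 / 16 * delaySum m τ)
      ≤ 7 / 8 * (γ / m) - γ / 2 * (1 + L * γ) * (1 / m) ∧ L * γ ≤ 1 / 51 := by
  have hm' : (1 : ℝ) ≤ m := by exact_mod_cast hm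
  have hτ' : (1 : ℝ) ≤ τ := by exact_mod_cast hτ
  have h0 : (0 : ℝ) < m := by linarith
  have hLγ : 0 < L * γ := by positivity
  have hS := delaySum_le hm hτ
  have hS0 := delaySum_nonneg m τ
  unfold stepQuantity at hstep
  set B := ((τ : ℝ) ^ 2 + τ) / m + 2 * τ with hB
  have hB2 : 2 ≤ B := by
    have : 0 ≤ ((τ : ℝ) ^ 2 + τ) / m := by positivity
    linarith
  have h1 : delaySum m τ ^ 2 ≤ B ^ 2 := pow_le_pow_left₀ hS0 hS 2
  have h2 : (4 : ℝ) ≤ B ^ 2 := by nlinarith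
  -- `51 = 3 + 12 · 4`, from `B² ≥ 4`.
  have h3 : L * γ ≤ 1 / 51 := by nlinarith
  refine ⟨?_, h3⟩
  have h4 : L * γ * delaySum m τ ^ 2 ≤ 1 / 12 := by nlinarith
  have h5 : L * γ / m ≤ 1 / 51 := (div_le_self hLγ.le hm').trans h3
  have h6 : 0 < L * γ / m := by positivity
  have e : (L / 2 + 2 * L ^ 2 * γ / m) * delaySum m τ * (γ ^ 2 / m) * (81 / 16 * delaySum m τ)
      = γ / m * ((1 / 2 + 2 * (L * γ / m)) * (81 / 16) * (L * γ * delaySum m τ ^ 2)) := by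
    ring
  have e' : 7 / 8 * (γ / m) - γ / 2 * (1 + L * γ) * (1 / m)
      = γ / m * (7 / 8 - 1 / 2 * (1 + L * γ)) := by
    ring
  rw [e, e']
  have h7 : (1 / 2 + 2 * (L * γ / m)) * (81 / 16) * (L * γ * delaySum m τ ^ 2)
      ≤ (1 / 2 + 2 * (1 / 51)) * (81 / 16) * (1 / 12) := by
    gcongr
  refine mul_le_mul_of_nonneg_left (h7.trans ?_) (by positivity)
  linarith

section

variable {Ω : Type u} {Ξ : Type v} [mΩ : MeasurableSpace Ω] [MeasurableSpace Ξ] {m n : ℕ}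
  {P : Measure Ω} {ℱ : Filtration ℕ mΩ} {D : Measure Ξ}
  {φ : BlockVec m n → ℝ} {Φ : BlockVec m n → Ξ → ℝ} {γ : ℝ} {τ K : ℕ} {M : ℕ → ℕ}
  {J : ℕ → Fin m → Ω → ℕ} {i : ℕ → Ω → Fin m} {ξ : ℕ → ℕ → Ω → Ξ} {x₀ : BlockVec m n}
  {lam zeta eta w : ℕ → Ω → BlockVec m n} [IsProbabilityMeasure P] [IsProbabilityMeasure D]

namespace IsRandomASBCDS

/-- The one-step inequalities are summed with delay error, gain and noise kept apart; the error is
absorbed only after the sums are exchanged. -/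
theorem integral_potential_le (h : IsRandomASBCDS P ℱ D Φ γ τ K M J i ξ x₀ lam zeta eta w)
    (hm : 1 ≤ m) (hM : ∀ k, 1 ≤ M k) (hγ : 0 < γ) {L : ℝ} (hL : 0 < L)
    (hc : ConvexOn ℝ Set.univ φ) (hφ : IsSmoothFun L φ)
    (hΦ : IsStochasticModel φ Φ D) {u : BlockVec m n} (hu : IsMinOn φ Set.univ u)
    (hnoise : ∀ k < K, MemLp
      (fun ω => gradient φ (w (k + 1) ω) - randGrad Φ M ξ w (k + 1) ω) 2 P)
    {k : ℕ} (hk : k ≤ K) :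
    (invTheta m (k + 1) ^ 2 - invTheta m (k + 1)) * ∫ ω, (φ (eta k ω) - φ u) ∂P
        + m ^ 2 / (2 * γ) * ∫ ω, ‖zeta k ω - u‖ ^ 2 ∂P
      ≤ (invTheta m 1 ^ 2 - invTheta m 1) * (φ x₀ - φ u) + m ^ 2 / (2 * γ) * ‖x₀ - u‖ ^ 2
        + (L / 2 + 2 * L ^ 2 * γ / m) * delaySum m τ * (γ ^ 2 / m)
          * ∑ j ∈ Finset.range k, invTheta m (j + 1) ^ 2 * ∑ q ∈ Finset.range j,
              delayWeight m τ (j - q) * ∫ ω, ‖randGrad Φ M ξ w (q + 1) ω‖ ^ 2 ∂P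
        - (7 / 8 * (γ / m) - γ / 2 * (1 + L * γ) * (1 / m))
          * ∑ j ∈ Finset.range k,
              invTheta m (j + 1) ^ 2 * ∫ ω, ‖randGrad Φ M ξ w (j + 1) ω‖ ^ 2 ∂P
        + 7 / 8 * (γ / m) * ∑ j ∈ Finset.range k, invTheta m (j + 1) ^ 2
          * ∫ ω, ‖gradient φ (w (j + 1) ω) - randGrad Φ M ξ w (j + 1) ω‖ ^ 2 ∂P := by
  induction k with
  | zero =>
    have e1 : ∀ ω, eta 0 ω = x₀ := fun ω => (h.run ω).eta_zero
    have e2 : ∀ ω, zeta 0 ω = x₀ := fun ω => (h.run ω).zeta_zero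
    simp [e1, e2]
  | succ k ih =>
    have hk : k < K := hk
    have ih := ih hk.le
    have h1 := h.integral_potential_succ_le hm hM hγ hφ hΦ hu hnoise hk
    have h2 := h.integral_model_le hm hM hγ hc hφ hΦ hu hnoise hk
    have h3 := h.integral_norm_sq_sub_compensated_le hm hφ hΦ hnoise hk
    have h4 : 0 ≤ invTheta m (k + 1) ^ 2 * (L / 2 + 2 * L ^ 2 * γ / m) := by positivity
    have h5 := mul_le_mul_of_nonneg_left h3 h4
    rw [invTheta_sq_sub hm k, Finset.sum_range_succ, Finset.sum_range_succ, Finset.sum_range_succ]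
    linear_combination h1 + h2 + h5 + ih

/-- The convergence rate of the iterates. -/
theorem integral_sub_le (h : IsRandomASBCDS P ℱ D Φ γ τ K M J i ξ x₀ lam zeta eta w)
    (hτ : 1 ≤ τ) (hτm : τ ≤ m) (hM : ∀ k, 1 ≤ M k) (hγ : 0 < γ) {L ε : ℝ} (hL : 0 < L)
    (hε : 0 < ε) (hstep : stepQuantity m τ L γ ≤ 1)
    (hc : ConvexOn ℝ Set.univ φ) (hφ : IsSmoothFun L φ)
    (hΦ : IsStochasticModel φ Φ D) {u : BlockVec m n} (hu : IsMinOn φ Set.univ u)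
    (hnoise : ∀ k < K, MemLp
      (fun ω => gradient φ (w (k + 1) ω) - randGrad Φ M ξ w (k + 1) ω) 2 P)
    (hbound : ∀ k < K,
      ∫ ω, ‖gradient φ (w (k + 1) ω) - randGrad Φ M ξ w (k + 1) ω‖ ^ 2 ∂P
        ≤ m * L * theta m (k + 1) * ε / 8) (hK : 1 ≤ K) :
    invTheta m K ^ 2 * ∫ ω, (φ (eta K ω) - φ u) ∂P
      ≤ m ^ 2 * (L / 2 + 1 / (2 * γ)) * ‖x₀ - u‖ ^ 2 + invTheta m K ^ 2 * (ε / 2) := by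
  have hm : 1 ≤ m := hτ.trans hτm
  have hm' : (1 : ℝ) ≤ m := by exact_mod_cast hm
  have h0 : (0 : ℝ) < m := by linarith
  obtain ⟨hdel, hLγ⟩ := delay_error_le hm hτ hL hγ hstep
  have h1 := h.integral_potential_le hm hM hγ hL hc hφ hΦ hu hnoise le_rfl
  have h2 := sum_sq_invTheta_mul_delay_le hm hτm
    (b := fun q => ∫ ω, ‖randGrad Φ M ξ w (q + 1) ω‖ ^ 2 ∂P)
    (fun q => integral_nonneg fun ω => sq_nonneg _) K
  have h3 : 0 ≤ ∑ j ∈ Finset.range K,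
      invTheta m (j + 1) ^ 2 * ∫ ω, ‖randGrad Φ M ξ w (j + 1) ω‖ ^ 2 ∂P :=
    Finset.sum_nonneg fun j _ => mul_nonneg (sq_nonneg _)
      (integral_nonneg fun ω => sq_nonneg _)
  have h4 : 0 ≤ (L / 2 + 2 * L ^ 2 * γ / m) * delaySum m τ * (γ ^ 2 / m) :=
    mul_nonneg (mul_nonneg (by positivity) (delaySum_nonneg m τ)) (by positivity)
  have h5 : ∑ j ∈ Finset.range K, invTheta m (j + 1) ^ 2
      * ∫ ω, ‖gradient φ (w (j + 1) ω) - randGrad Φ M ξ w (j + 1) ω‖ ^ 2 ∂P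
      ≤ m * L * ε / 8 * invTheta m K ^ 2 := by
    have h6 : ∀ j ∈ Finset.range K, invTheta m (j + 1) ^ 2
        * ∫ ω, ‖gradient φ (w (j + 1) ω) - randGrad Φ M ξ w (j + 1) ω‖ ^ 2 ∂P
        ≤ m * L * ε / 8 * invTheta m (j + 1) := by
      intro j hj
      refine (mul_le_mul_of_nonneg_left (hbound j (Finset.mem_range.1 hj))
        (sq_nonneg _)).trans (le_of_eq ?_)
      -- The factor `θ` in the variance bound cancels one power of `1/θ`, so the noise sums to a
      -- multiple of the final squared reciprocal.
      linear_combination (m * L * ε / 8 * invTheta m (j + 1)) * theta_mul_invTheta hm (j + 1)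
    refine (Finset.sum_le_sum h6).trans ?_
    rw [← Finset.mul_sum]
    exact mul_le_mul_of_nonneg_left (sum_invTheta_le hm K) (by positivity)
  have h7 : φ x₀ - φ u ≤ L / 2 * ‖x₀ - u‖ ^ 2 := by
    have := le_add_inner_gradient_add hφ.1 hφ.2 u x₀
    rw [hu.gradient_eq_zero, inner_zero_left] at this
    linarith
  have h8 : 0 ≤ φ x₀ - φ u := sub_nonneg.2 (hu (Set.mem_univ _))
  have h9 : 0 ≤ ∫ ω, ‖zeta K ω - u‖ ^ 2 ∂P := integral_nonneg fun ω => sq_nonneg _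
  obtain ⟨K, rfl⟩ : ∃ K', K = K' + 1 := ⟨K - 1, by omega⟩
  rw [invTheta_sq_sub hm K, invTheta_one] at h1
  have h10 := mul_le_mul_of_nonneg_left h2 h4
  have h11 := mul_le_mul_of_nonneg_right hdel h3
  have h12 := mul_le_mul_of_nonneg_left h5 (show 0 ≤ 7 / 8 * (γ / m) by positivity)
  have h13 : 7 / 8 * (γ / m) * (m * L * ε / 8 * invTheta m (K + 1) ^ 2)
      ≤ invTheta m (K + 1) ^ 2 * (ε / 2) := by
    have e : 7 / 8 * (γ / m) * (m * L * ε / 8 * invTheta m (K + 1) ^ 2)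
        = 7 / 64 * (L * γ) * (invTheta m (K + 1) ^ 2 * ε) := by
      field_simp
      ring
    rw [e]
    have : 0 ≤ invTheta m (K + 1) ^ 2 * ε := by positivity
    nlinarith
  have h14 : ((m : ℝ) ^ 2 - m) * (φ x₀ - φ u) ≤ m ^ 2 * (L / 2 * ‖x₀ - u‖ ^ 2) := by
    nlinarith [mul_le_mul_of_nonneg_left h7 (sq_nonneg (m : ℝ)), mul_nonneg h0.le h8]
  have h15 : 0 ≤ (m : ℝ) ^ 2 / (2 * γ) * ∫ ω, ‖zeta (K + 1) ω - u‖ ^ 2 ∂P :=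
    mul_nonneg (by positivity) h9
  have e : (m : ℝ) ^ 2 * (L / 2 + 1 / (2 * γ)) * ‖x₀ - u‖ ^ 2
      = m ^ 2 * (L / 2 * ‖x₀ - u‖ ^ 2) + m ^ 2 / (2 * γ) * ‖x₀ - u‖ ^ 2 := by
    ring
  rw [e]
  linarith

end IsRandomASBCDS

end

/-! ### The variance of mini-batch gradients -/

/-- Variance bounds are stated with `∫⁻`, so that they carry square integrability instead of
presupposing it. -/
theorem memLp_two_of_lintegral_le {Ω V : Type*} [MeasurableSpace Ω] {P : Measure Ω}
    [NormedAddCommGroup V] {f : Ω → V} (hf : AEStronglyMeasurable f P) {b : ℝ} (hb : 0 ≤ b)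
    (h : ∫⁻ ω, ‖f ω‖ₑ ^ 2 ∂P ≤ ENNReal.ofReal b) :
    MemLp f 2 P ∧ ∫ ω, ‖f ω‖ ^ 2 ∂P ≤ b := by
  have e : ∀ ω, ‖‖f ω‖ ^ 2‖ₑ = ‖f ω‖ₑ ^ 2 := fun ω => by rw [enorm_pow, enorm_norm]
  have hm : AEStronglyMeasurable (fun ω => ‖f ω‖ ^ 2) P := hf.norm.pow 2
  constructor
  · refine (memLp_two_iff_integrable_sq_norm hf).2 ⟨hm, ?_⟩
    rw [HasFiniteIntegral]
    simp_rw [e]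
    exact h.trans_lt ENNReal.ofReal_lt_top
  · rw [integral_eq_lintegral_of_nonneg_ae (Filter.Eventually.of_forall fun ω => sq_nonneg _) hm]
    refine ENNReal.toReal_le_of_le_ofReal hb (le_trans (le_of_eq ?_) h)
    refine lintegral_congr fun ω => ?_
    rw [← e, Real.enorm_of_nonneg (sq_nonneg _)]

theorem lintegral_enorm_sq_eq {Ω V : Type*} [MeasurableSpace Ω] {P : Measure Ω}
    [NormedAddCommGroup V] {f : Ω → V} (hf : MemLp f 2 P) :
    ∫⁻ ω, ‖f ω‖ₑ ^ 2 ∂P = ENNReal.ofReal (∫ ω, ‖f ω‖ ^ 2 ∂P) := by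
  rw [ofReal_integral_eq_lintegral_ofReal (hf.integrable_norm_pow (by norm_num))
    (Filter.Eventually.of_forall fun ω => sq_nonneg _)]
  refine lintegral_congr fun ω => ?_
  rw [ENNReal.ofReal_pow (norm_nonneg _), ofReal_norm]

theorem memLp_average_pi {Ξ V : Type*} [MeasurableSpace Ξ] {D : Measure Ξ}
    [IsProbabilityMeasure D] [NormedAddCommGroup V] [NormedSpace ℝ V]
    {f : Ξ → V} (hf : MemLp f 2 D) (N : ℕ) :
    MemLp (fun s : Fin N → Ξ => (N : ℝ)⁻¹ • ∑ r, f (s r)) 2 (Measure.pi fun _ => D) := by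
  have h1 : ∀ r ∈ (Finset.univ : Finset (Fin N)),
      MemLp (fun s : Fin N → Ξ => f (s r)) 2 (Measure.pi fun _ => D) := fun r _ =>
    hf.comp_measurePreserving (measurePreserving_eval (fun _ : Fin N => D) r)
  have h2 : MemLp (fun s : Fin N → Ξ => ∑ r, f (s r)) 2 (Measure.pi fun _ => D) :=
    memLp_finsetSum _ h1
  exact h2.const_smul (N : ℝ)⁻¹

/-- The cross terms vanish by independence and centering. -/
theorem integral_norm_sq_sum_pi {Ξ V : Type*} [MeasurableSpace Ξ] {D : Measure Ξ}
    [IsProbabilityMeasure D] [NormedAddCommGroup V] [InnerProductSpace ℝ V] [CompleteSpace V]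
    {f : Ξ → V} (hf : MemLp f 2 D) (h0 : ∫ s, f s ∂D = 0) (N : ℕ) :
    ∫ s, ‖∑ r, f (s r)‖ ^ 2 ∂(Measure.pi fun _ : Fin N => D) = N * ∫ s, ‖f s‖ ^ 2 ∂D := by
  have hmem : ∀ r : Fin N, MemLp (fun s : Fin N → Ξ => f (s r)) 2 (Measure.pi fun _ => D) :=
    fun r => hf.comp_measurePreserving (measurePreserving_eval (fun _ : Fin N => D) r)
  have hint := hf.integrable one_le_two
  have hind : iIndepFun (fun (r : Fin N) (s : Fin N → Ξ) => s r) (Measure.pi fun _ => D) :=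
    iIndepFun_pi (X := fun _ s => s) fun _ => aemeasurable_id
  have hoff : ∀ r q : Fin N, r ≠ q →
      ∫ s : Fin N → Ξ, inner ℝ (f (s r)) (f (s q)) ∂(Measure.pi fun _ => D) = 0 := by
    intro r q hrq
    have hmap : ∀ r : Fin N, Measure.map (fun s : Fin N → Ξ => s r) (Measure.pi fun _ => D) = D :=
      fun r => (measurePreserving_eval (fun _ : Fin N => D) r).map_eq
    have h1 : ∫ s : Fin N → Ξ, inner ℝ (f (s r)) (f (s q)) ∂(Measure.pi fun _ => D)
        = inner ℝ (∫ s : Fin N → Ξ, f (s r) ∂(Measure.pi fun _ => D))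
          (∫ s : Fin N → Ξ, f (s q) ∂(Measure.pi fun _ => D)) :=
      (hind.indepFun hrq).integral_bilin_comp_comp (f := f) (g := f)
        (measurable_pi_apply r).aemeasurable (measurable_pi_apply q).aemeasurable
        (by rwa [hmap]) (by rwa [hmap]) (innerSL ℝ)
    rw [h1, integral_comp_eval (μ := fun _ : Fin N => D) hint.aestronglyMeasurable, h0,
      inner_zero_left]
  have e : ∀ s : Fin N → Ξ,
      ‖∑ r, f (s r)‖ ^ 2 = ∑ r, ∑ q, inner ℝ (f (s r)) (f (s q)) := by
    intro s
    rw [← real_inner_self_eq_norm_sq, sum_inner]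
    simp_rw [inner_sum]
  simp_rw [e]
  have hi : ∀ r q : Fin N, Integrable (fun s : Fin N → Ξ => inner ℝ (f (s r)) (f (s q)))
      (Measure.pi fun _ => D) := fun r q => integrable_inner_of_memLp (hmem r) (hmem q)
  rw [integral_finsetSum _ fun r _ => integrable_finsetSum _ fun q _ => hi r q]
  have h2 : ∀ r : Fin N, ∫ s : Fin N → Ξ, ∑ q, inner ℝ (f (s r)) (f (s q))
      ∂(Measure.pi fun _ => D) = ∫ s, ‖f s‖ ^ 2 ∂D := by
    intro r
    rw [integral_finsetSum _ fun q _ => hi r q,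
      Finset.sum_eq_single r (fun q _ hq => hoff r q hq.symm) (by simp)]
    simp_rw [real_inner_self_eq_norm_sq]
    exact integral_comp_eval (μ := fun _ : Fin N => D) (f := fun s => ‖f s‖ ^ 2)
      (hf.1.norm.pow 2)
  simp [h2]

section

variable {m n : ℕ} {Ξ : Type v} [MeasurableSpace Ξ] {D : Measure Ξ} [IsProbabilityMeasure D]
  {φ : BlockVec m n → ℝ} {Φ : BlockVec m n → Ξ → ℝ}

theorem IsStochasticModel.lintegral_finBatchGrad_le (h : IsStochasticModel φ Φ D) {σ : ℝ}
    (x : BlockVec m n)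
    (hσ : ∫⁻ s, ‖gradient φ x - stochGrad Φ x s‖ₑ ^ 2 ∂D ≤ ENNReal.ofReal (σ ^ 2)) {N : ℕ}
    (hN : 1 ≤ N) :
    ∫⁻ s, ‖gradient φ x - finBatchGrad Φ N s x‖ₑ ^ 2 ∂(Measure.pi fun _ : Fin N => D)
      ≤ ENNReal.ofReal (σ ^ 2 / N) := by
  have hN' : (0 : ℝ) < N := by exact_mod_cast hN
  obtain ⟨hf, hfσ⟩ := memLp_two_of_lintegral_le (f := fun s => gradient φ x - stochGrad Φ x s)
    (aestronglyMeasurable_const.sub (h.integrable_grad x).1) (sq_nonneg σ) hσ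
  have h0 : ∫ s, (gradient φ x - stochGrad Φ x s) ∂D = 0 := by
    rw [integral_sub (integrable_const _) (h.integrable_grad x), h.mean_grad]
    simp
  have e : ∀ s : Fin N → Ξ, gradient φ x - finBatchGrad Φ N s x
      = (N : ℝ)⁻¹ • ∑ r, (gradient φ x - stochGrad Φ x (s r)) := by
    intro s
    rw [Finset.sum_sub_distrib, smul_sub, finBatchGrad]
    congr 1
    rw [Finset.sum_const, Finset.card_univ, Fintype.card_fin, ← Nat.cast_smul_eq_nsmul ℝ,
      smul_smul, inv_mul_cancel₀ hN'.ne', one_smul]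
  have hmem : MemLp (fun s : Fin N → Ξ => gradient φ x - finBatchGrad Φ N s x) 2
      (Measure.pi fun _ => D) := by
    simp_rw [e]
    exact memLp_average_pi hf N
  rw [lintegral_enorm_sq_eq hmem]
  refine ENNReal.ofReal_le_ofReal ?_
  simp_rw [e, norm_smul, mul_pow]
  rw [integral_const_mul, integral_norm_sq_sum_pi hf h0, Real.norm_of_nonneg (by positivity)]
  rw [le_div_iff₀ hN']
  refine le_trans (le_of_eq ?_) hfσ
  field_simp

end

section

variable {Ω : Type u} {Ξ : Type v} [mΩ : MeasurableSpace Ω] [MeasurableSpace Ξ] {m n : ℕ}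
  {P : Measure Ω} {ℱ : Filtration ℕ mΩ} {D : Measure Ξ}
  {φ : BlockVec m n → ℝ} {Φ : BlockVec m n → Ξ → ℝ} {γ : ℝ} {τ K : ℕ} {M : ℕ → ℕ}
  {J : ℕ → Fin m → Ω → ℕ} {i : ℕ → Ω → Fin m} {ξ : ℕ → ℕ → Ω → Ξ} {x₀ : BlockVec m n}
  {lam zeta eta w : ℕ → Ω → BlockVec m n} [IsProbabilityMeasure P] [IsProbabilityMeasure D]

/-- The samples are independent of `w (k + 1)`, so Tonelli reduces the claim to a fixed evaluation
point. -/
theorem IsRandomASBCDS.lintegral_noise_le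
    (h : IsRandomASBCDS P ℱ D Φ γ τ K M J i ξ x₀ lam zeta eta w)
    (hm : 1 ≤ m) (hM : ∀ k, 1 ≤ M k) {L : ℝ} (hφ : IsSmoothFun L φ) (hΦ : IsStochasticModel φ Φ D)
    {σ : ℝ}
    (hσ : ∀ x, ∫⁻ s, ‖gradient φ x - stochGrad Φ x s‖ₑ ^ 2 ∂D ≤ ENNReal.ofReal (σ ^ 2))
    {k : ℕ} (hk : k < K) :
    ∫⁻ ω, ‖gradient φ (w (k + 1) ω) - randGrad Φ M ξ w (k + 1) ω‖ₑ ^ 2 ∂P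
      ≤ ENNReal.ofReal (σ ^ 2 / M (k + 1)) := by
  have hw := h.measurable_w hΦ hk
  have hw' : Measurable (w (k + 1)) := hw.mono (ℱ.le k) le_rfl
  have hY := h.sampling.measurable_samples hk
  have : IsProbabilityMeasure (P.map (w (k + 1))) :=
    Measure.isProbabilityMeasure_map hw'.aemeasurable
  have hlaw := (indepFun_iff_map_prod_eq_prod_map_map hY.aemeasurable hw'.aemeasurable).1
    (h.sampling.indepFun_samples_past hk hw)
  rw [h.sampling.map_samples hm hk] at hlaw
  have hF : Measurable (fun q : (Fin (M (k + 1)) → Ξ) × BlockVec m n =>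
      ‖gradient φ q.2 - finBatchGrad Φ (M (k + 1)) q.1 q.2‖ₑ ^ 2) :=
    ((hφ.continuous_gradient.measurable.comp measurable_snd).sub
      (hΦ.measurable_finBatchGrad (M (k + 1)))).enorm.pow_const 2
  simp only [randGrad, batchGrad_eq_finBatchGrad]
  rw [← lintegral_map (f := fun q : (Fin (M (k + 1)) → Ξ) × BlockVec m n =>
      ‖gradient φ q.2 - finBatchGrad Φ (M (k + 1)) q.1 q.2‖ₑ ^ 2) hF (hY.prodMk hw'), hlaw,
    lintegral_prod_symm' _ hF]
  refine (lintegral_mono fun x =>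
    hΦ.lintegral_finBatchGrad_le x (hσ x) (hM (k + 1))).trans ?_
  simp

/-! ### Complexity -/

/-- The constant in the iteration complexity. -/
noncomputable def rateConst (c : ℝ) : ℝ := √(784 / c)

/-- The lower bound `c` keeps `γ` from being too small: since `τ ≤ m`, it gives `c ≤ (3 + 12 · 16) L
γ τ²`. Then `98 = 195/2 + 1/2`. -/
theorem inv_stepSize_le {m τ : ℕ} {L γ c : ℝ} (hτ : 1 ≤ τ) (hτm : τ ≤ m) (hL : 0 < L)
    (hγ : 0 < γ) (hc : 0 < c) (h : c ≤ stepQuantity m τ L γ) (h1 : stepQuantity m τ L γ ≤ 1) :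
    L / 2 + 1 / (2 * γ) ≤ 98 * L * τ ^ 2 / c := by
  have hτ' : (1 : ℝ) ≤ τ := by exact_mod_cast hτ
  have hτm' : (τ : ℝ) ≤ m := by exact_mod_cast hτm
  have h0 : (0 : ℝ) < m := by linarith
  have hB : ((τ : ℝ) ^ 2 + τ) / m + 2 * τ ≤ 4 * τ := by
    have : ((τ : ℝ) ^ 2 + τ) / m ≤ 2 * τ := by
      rw [div_le_iff₀ h0]
      nlinarith
    linarith
  have hB0 : 0 ≤ ((τ : ℝ) ^ 2 + τ) / m + 2 * τ := by positivity
  have hB2 := pow_le_pow_left₀ hB0 hB 2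
  have hLγ : 0 < L * γ := by positivity
  have hτ2 : 1 ≤ (τ : ℝ) ^ 2 := one_le_pow₀ hτ'
  have h2 : c ≤ 195 * (L * γ) * τ ^ 2 := by
    unfold stepQuantity at h
    nlinarith [mul_le_mul_of_nonneg_left hB2 hLγ.le, mul_le_mul_of_nonneg_left hτ2 hLγ.le]
  have hc1 : c ≤ 1 := h.trans h1
  have h3 : 1 / (2 * γ) ≤ 195 / 2 * L * τ ^ 2 / c := by
    rw [div_le_div_iff₀ (by positivity) hc]
    nlinarith
  have h4 : L / 2 ≤ 1 / 2 * L * τ ^ 2 / c := by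
    rw [div_le_div_iff₀ two_pos hc]
    nlinarith [mul_le_mul_of_nonneg_left hc1 hL.le, mul_le_mul_of_nonneg_left hτ2 hL.le]
  calc L / 2 + 1 / (2 * γ) ≤ 1 / 2 * L * τ ^ 2 / c + 195 / 2 * L * τ ^ 2 / c := add_le_add h4 h3
    _ = 98 * L * τ ^ 2 / c := by ring

theorem IsRandomASBCDS.integral_sub_le_eps
    (h : IsRandomASBCDS P ℱ D Φ γ τ K M J i ξ x₀ lam zeta eta w) {L ε c : ℝ}
    (hc0 : 0 < c) (hτ : 1 ≤ τ) (hτm : τ ≤ m) (hL : 0 < L) (hγ : 0 < γ) (hε : 0 < ε)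
    (hM : ∀ k, 1 ≤ M k) (hcstep : c ≤ stepQuantity m τ L γ) (hstep : stepQuantity m τ L γ ≤ 1)
    (hc : ConvexOn ℝ Set.univ φ) (hφ : IsSmoothFun L φ) {u : BlockVec m n}
    (hu : IsMinOn φ Set.univ u) (hΦ : IsStochasticModel φ Φ D)
    (hnoise : ∀ k < K, ∫⁻ ω, ‖gradient φ (w (k + 1) ω) - randGrad Φ M ξ w (k + 1) ω‖ₑ ^ 2 ∂P
        ≤ ENNReal.ofReal (m * L * theta m (k + 1) * ε / 8))
    (hK : rateConst c * (m * τ * √L * ‖x₀ - u‖ / √ε) ≤ K) :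
    Integrable (fun ω => φ (eta K ω)) P ∧ ∫ ω, φ (eta K ω) ∂P - φ u ≤ ε := by
  have hm : 1 ≤ m := hτ.trans hτm
  have hm' : (1 : ℝ) ≤ m := by exact_mod_cast hm
  have h0 : (0 : ℝ) < m := by linarith
  have hτ' : (0 : ℝ) < τ := by exact_mod_cast hτ
  have hnoise' : ∀ k < K,
      MemLp (fun ω => gradient φ (w (k + 1) ω) - randGrad Φ M ξ w (k + 1) ω) 2 P
        ∧ ∫ ω, ‖gradient φ (w (k + 1) ω) - randGrad Φ M ξ w (k + 1) ω‖ ^ 2 ∂P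
          ≤ m * L * theta m (k + 1) * ε / 8 := by
    intro k hk
    have hw := h.measurable_w hΦ hk
    have hR := (h.measurable_randGrad hΦ hk hw).mono (ℱ.le (k + 1)) le_rfl
    have hth := theta_pos hm (k + 1)
    exact memLp_two_of_lintegral_le
      ((hφ.continuous_gradient.measurable.comp (hw.mono (ℱ.le k) le_rfl)).sub
        hR).aestronglyMeasurable (by positivity) (hnoise k hk)
  have heta := (h.memLp_iterates hm hφ hΦ (fun k hk => (hnoise' k hk).1) le_rfl K le_rfl).1
  have hint := integrable_smooth_comp hφ.1 hφ.2 hu heta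
  have hint' : Integrable (fun ω => φ (eta K ω)) P := by
    have e1 : (fun ω => φ (eta K ω)) = (fun ω => φ (eta K ω) - φ u) + fun _ => φ u := by
      funext ω
      simp
    exact e1 ▸ hint.add (integrable_const (φ u))
  have e : ∫ ω, (φ (eta K ω) - φ u) ∂P = ∫ ω, φ (eta K ω) ∂P - φ u := by
    rw [integral_sub hint' (integrable_const _)]
    simp
  refine ⟨hint', e ▸ ?_⟩
  set R := ‖x₀ - u‖ with hR
  have hR0 : 0 ≤ R := norm_nonneg _
  have hC : 0 < rateConst c := Real.sqrt_pos.2 (by positivity)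
  have hsL : 0 < √L := Real.sqrt_pos.2 hL
  have hsε : 0 < √ε := Real.sqrt_pos.2 hε
  -- With `K = 0` the lower bound on `K` forces the starting point to be the minimizer.
  rcases Nat.eq_zero_or_pos K with rfl | hK1
  · have hX : m * τ * √L * R / √ε ≤ 0 := by
      rw [Nat.cast_zero] at hK
      by_contra! hX
      nlinarith [mul_pos hC hX]
    have hR' : R = 0 := by
      by_contra hne
      have : 0 < R := lt_of_le_of_ne hR0 (Ne.symm hne)
      have : 0 < m * τ * √L * R / √ε := by positivity
      linarith
    have hx : x₀ = u := sub_eq_zero.1 (norm_eq_zero.1 hR')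
    have e1 : ∀ ω, eta 0 ω = x₀ := fun ω => (h.run ω).eta_zero
    simp [e1, hx, hε.le]
  have hmain := h.integral_sub_le hτ hτm hM hγ hL hε hstep hc hφ hΦ hu
    (fun k hk => (hnoise' k hk).1) (fun k hk => (hnoise' k hk).2) hK1
  have hinv := inv_stepSize_le hτ hτm hL hγ hc0 hcstep hstep
  have ht : (K : ℝ) / 2 ≤ invTheta m K := by
    obtain ⟨K, rfl⟩ : ∃ K', K = K' + 1 := ⟨K - 1, by omega⟩
    have := cast_le_invTheta hm K
    push_cast
    linarith
  -- `784 = 98 · 4 · 2`: the constant of `inv_stepSize_le`, the `4` from `t_K² ≥ K²/4`, and the half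
  -- of `ε` reserved for the initial potential.
  have hK2 : 784 / c * (m ^ 2 * τ ^ 2 * L * R ^ 2 / ε) ≤ K ^ 2 := by
    have := pow_le_pow_left₀ (by positivity) hK 2
    refine le_trans (le_of_eq ?_) this
    rw [rateConst, mul_pow, div_pow, mul_pow, mul_pow, mul_pow, Real.sq_sqrt (by positivity),
      Real.sq_sqrt hL.le, Real.sq_sqrt hε.le]
  have ht2 : (K : ℝ) ^ 2 / 4 ≤ invTheta m K ^ 2 := by
    have := pow_le_pow_left₀ (by positivity) ht 2
    linarith [this, show ((K : ℝ) / 2) ^ 2 = K ^ 2 / 4 by ring]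
  have h1 : m ^ 2 * (L / 2 + 1 / (2 * γ)) * R ^ 2 ≤ invTheta m K ^ 2 * (ε / 2) := by
    calc m ^ 2 * (L / 2 + 1 / (2 * γ)) * R ^ 2 ≤ m ^ 2 * (98 * L * τ ^ 2 / c) * R ^ 2 := by gcongr
      _ = 784 / c * (m ^ 2 * τ ^ 2 * L * R ^ 2 / ε) / 4 * (ε / 2) := by
        field_simp
        ring
      _ ≤ invTheta m K ^ 2 * (ε / 2) := by
        gcongr
        linarith
  have ht0 : 0 < invTheta m K ^ 2 := pow_pos (invTheta_pos hm K) 2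
  refine le_of_mul_le_mul_left ?_ ht0
  linarith

end

/-- Mini-batch sizes for the oracle complexity. -/
noncomputable def batchSize (m : ℕ) (L ε σ : ℝ) (k : ℕ) : ℕ :=
  ⌈8 * σ ^ 2 / (m * L * ε) * invTheta m k⌉₊ + 1

theorem monotone_batchSize {m : ℕ} (hm : 1 ≤ m) {L ε : ℝ} (hL : 0 < L) (hε : 0 < ε) (σ : ℝ) :
    Monotone (batchSize m L ε σ) := by
  refine monotone_nat_of_le_succ fun k => ?_
  unfold batchSize
  have := invTheta_mono_succ hm k
  gcongr

theorem sq_div_batchSize_le {m : ℕ} (hm : 1 ≤ m) {L ε : ℝ} (hL : 0 < L) (hε : 0 < ε) (σ : ℝ)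
    (k : ℕ) : σ ^ 2 / batchSize m L ε σ k ≤ m * L * theta m k * ε / 8 := by
  have h0 : (0 : ℝ) < m := by exact_mod_cast hm
  have hth := theta_pos hm k
  have hN : (0 : ℝ) < batchSize m L ε σ k := by
    rw [batchSize]
    positivity
  have h1 : 8 * σ ^ 2 / (m * L * ε) * invTheta m k ≤ batchSize m L ε σ k := by
    rw [batchSize]
    push_cast
    linarith [Nat.le_ceil (8 * σ ^ 2 / (m * L * ε) * invTheta m k)]
  rw [div_le_iff₀ hN]
  calc σ ^ 2 = m * L * theta m k * ε / 8 * (8 * σ ^ 2 / (m * L * ε) * invTheta m k) := by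
        rw [invTheta]
        field_simp
    _ ≤ _ := by gcongr

theorem oracleCalls_batchSize_le {m : ℕ} (hm : 1 ≤ m) {L ε : ℝ} (hL : 0 < L) (hε : 0 < ε) (σ : ℝ)
    (K : ℕ) :
    (oracleCalls (batchSize m L ε σ) K : ℝ)
      ≤ 8 * σ ^ 2 / (m * L * ε) * invTheta m K ^ 2 + 2 * K := by
  have h0 : (0 : ℝ) < m := by exact_mod_cast hm
  have e : oracleCalls (batchSize m L ε σ) K
      = ∑ k ∈ Finset.range K, batchSize m L ε σ (k + 1) := by
    rw [oracleCalls, Finset.range_eq_Ico, Finset.sum_Ico_add' _ 0 K 1]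
    rfl
  rw [e]
  push_cast
  have h1 : ∀ k ∈ Finset.range K, (batchSize m L ε σ (k + 1) : ℝ)
      ≤ 8 * σ ^ 2 / (m * L * ε) * invTheta m (k + 1) + 2 := by
    intro k _
    have ht := invTheta_pos hm (k + 1)
    have := (Nat.ceil_lt_add_one
      (show 0 ≤ 8 * σ ^ 2 / (m * L * ε) * invTheta m (k + 1) by positivity)).le
    rw [batchSize]
    push_cast
    linarith
  refine (Finset.sum_le_sum h1).trans ?_
  rw [Finset.sum_add_distrib, ← Finset.mul_sum, Finset.sum_const, Finset.card_range, nsmul_eq_mul,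
    mul_comm (K : ℝ) 2]
  have := sum_invTheta_le hm K
  gcongr

/-- The hypothesis `2ε < L R²` gives `X ≥ m ≥ 1` for the target `X = m τ √L R / √ε`. Hence rounding
up `K` and the initial value `t_1 = m` cost only constant factors: `t_K ≤ m + K ≤ (C + 2) X`. -/
theorem exists_batch_complexity {m τ : ℕ} (hτ : 1 ≤ τ) (hτm : τ ≤ m) {L ε R : ℝ} (hL : 0 < L)
    (hε : 0 < ε) (hR : 0 ≤ R) (σ C : ℝ) (hC : 0 ≤ C) (hLR : 2 * ε < L * R ^ 2) :
    ∃ K : ℕ, C * (m * τ * √L * R / √ε) ≤ K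
      ∧ (K : ℝ) ≤ 8 * (C + 2) ^ 2 * (m * τ * √L * R / √ε)
      ∧ (oracleCalls (batchSize m L ε σ) K : ℝ) ≤ 8 * (C + 2) ^ 2
          * (m * τ * √L * R / √ε + m * τ ^ 2 * σ ^ 2 * R ^ 2 / ε ^ 2) := by
  have hm : 1 ≤ m := hτ.trans hτm
  have hm' : (1 : ℝ) ≤ m := by exact_mod_cast hm
  have h0 : (0 : ℝ) < m := by linarith
  have hτ' : (1 : ℝ) ≤ τ := by exact_mod_cast hτ
  have hsL : 0 < √L := Real.sqrt_pos.2 hL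
  have hsε : 0 < √ε := Real.sqrt_pos.2 hε
  have hr : 1 ≤ √L * R / √ε := by
    have h1 : 1 ≤ (√L * R / √ε) ^ 2 := by
      rw [div_pow, mul_pow, Real.sq_sqrt hL.le, Real.sq_sqrt hε.le, le_div_iff₀ hε]
      linarith
    exact (one_le_sq_iff₀ (by positivity)).1 h1
  set X := m * τ * √L * R / √ε with hX
  have hXm : (m : ℝ) ≤ X := by
    have e : X = m * τ * (√L * R / √ε) := by
      rw [hX]
      ring
    rw [e]
    have : (1 : ℝ) ≤ τ * (√L * R / √ε) := by nlinarith
    nlinarith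
  have hX2 : X ^ 2 = m ^ 2 * τ ^ 2 * L * R ^ 2 / ε := by
    rw [hX, div_pow, mul_pow, mul_pow, mul_pow, Real.sq_sqrt hL.le, Real.sq_sqrt hε.le]
  have hX1 : 1 ≤ X := hm'.trans hXm
  have hKle : (⌈C * X⌉₊ : ℝ) ≤ (C + 1) * X := by
    have := (Nat.ceil_lt_add_one (show 0 ≤ C * X by positivity)).le
    linarith
  have hKpos : 0 < (C + 2) ^ 2 := by positivity
  refine ⟨⌈C * X⌉₊, Nat.le_ceil _, ?_, ?_⟩
  · nlinarith
  · have ht : invTheta m ⌈C * X⌉₊ ≤ (C + 2) * X := by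
      have h1 : invTheta m ⌈C * X⌉₊ ≤ m + ⌈C * X⌉₊ := by
        cases ⌈C * X⌉₊ with
        | zero => simpa [invTheta, theta] using hm'
        | succ K =>
          have := invTheta_add_le hm 0 K
          rw [zero_add, invTheta_one, add_comm 1 K] at this
          push_cast
          have : (0 : ℝ) ≤ K := by positivity
          linarith
      linarith
    have ht2 := pow_le_pow_left₀ (invTheta_pos hm ⌈C * X⌉₊).le ht 2
    have h1 := oracleCalls_batchSize_le hm hL hε σ ⌈C * X⌉₊
    have h2 : 8 * σ ^ 2 / (m * L * ε) * invTheta m ⌈C * X⌉₊ ^ 2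
        ≤ 8 * (C + 2) ^ 2 * (m * τ ^ 2 * σ ^ 2 * R ^ 2 / ε ^ 2) := by
      calc 8 * σ ^ 2 / (m * L * ε) * invTheta m ⌈C * X⌉₊ ^ 2
          ≤ 8 * σ ^ 2 / (m * L * ε) * ((C + 2) * X) ^ 2 := by gcongr
        _ = _ := by
          rw [mul_pow, hX2]
          field_simp
    rw [mul_add]
    nlinarith

theorem mainTheorem1 (c : ℝ) (hc : 0 < c) :
    ∃ C : ℝ, 0 < C ∧
      -- iteration complexity under the variance bound at the compensated points
      (∀ (m n τ K : ℕ) (M : ℕ → ℕ) (L γ ε : ℝ)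
          (Ω : Type u) (Ξ : Type v) (mΩ : MeasurableSpace Ω) (_ : MeasurableSpace Ξ)
          (P : Measure Ω) (_ : IsProbabilityMeasure P) (ℱ : Filtration ℕ mΩ)
          (D : Measure Ξ) (_ : IsProbabilityMeasure D)
          (φ : BlockVec m n → ℝ) (Φ : BlockVec m n → Ξ → ℝ)
          (J : ℕ → Fin m → Ω → ℕ) (i : ℕ → Ω → Fin m) (ξ : ℕ → ℕ → Ω → Ξ)
          (x₀ ηstar : BlockVec m n) (lam zeta eta w : ℕ → Ω → BlockVec m n),
          1 ≤ τ → τ ≤ m → 0 < L → 0 < γ → 0 < ε → (∀ k, 1 ≤ M k) →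
          c ≤ stepQuantity m τ L γ → stepQuantity m τ L γ ≤ 1 →
          ConvexOn ℝ Set.univ φ → IsSmoothFun L φ → IsMinOn φ Set.univ ηstar →
          IsStochasticModel φ Φ D →
          IsRandomASBCDS P ℱ D Φ γ τ K M J i ξ x₀ lam zeta eta w →
          (∀ k ∈ Finset.Icc 1 K,
            ∫⁻ ω, ‖gradient φ (w k ω) - batchGrad Φ (M k) (fun r => ξ k r ω) (w k ω)‖ₑ ^ 2 ∂P
              ≤ ENNReal.ofReal (m * L * theta m k * ε / 8)) →
          C * (m * τ * Real.sqrt L * ‖x₀ - ηstar‖ / Real.sqrt ε) ≤ K →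
          Integrable (fun ω => φ (eta K ω)) P ∧
            ∫ ω, φ (eta K ω) ∂P - φ ηstar ≤ ε) ∧
      -- oracle complexity under a uniform variance bound, with mini-batches
      (∀ (m τ : ℕ) (L γ ε σ R : ℝ),
          1 ≤ τ → τ ≤ m → 0 < L → 0 < γ → 0 < ε → 0 ≤ σ → 0 ≤ R →
          c ≤ stepQuantity m τ L γ → stepQuantity m τ L γ ≤ 1 →
          ∃ (K : ℕ) (M : ℕ → ℕ), (∀ k, 1 ≤ M k) ∧ Monotone M ∧
            (K : ℝ) ≤ C * (m * τ * Real.sqrt L * R / Real.sqrt ε) ∧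
            (oracleCalls M K : ℝ) ≤
              C * (m * τ * Real.sqrt L * R / Real.sqrt ε + m * τ ^ 2 * σ ^ 2 * R ^ 2 / ε ^ 2) ∧
            ∀ (n : ℕ) (Ω : Type u) (Ξ : Type v) (mΩ : MeasurableSpace Ω) (_ : MeasurableSpace Ξ)
              (P : Measure Ω) (_ : IsProbabilityMeasure P) (ℱ : Filtration ℕ mΩ)
              (D : Measure Ξ) (_ : IsProbabilityMeasure D)
              (φ : BlockVec m n → ℝ) (Φ : BlockVec m n → Ξ → ℝ)
              (J : ℕ → Fin m → Ω → ℕ) (i : ℕ → Ω → Fin m) (ξ : ℕ → ℕ → Ω → Ξ)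
              (x₀ ηstar : BlockVec m n) (lam zeta eta w : ℕ → Ω → BlockVec m n),
              ConvexOn ℝ Set.univ φ → IsSmoothFun L φ → IsMinOn φ Set.univ ηstar →
              IsStochasticModel φ Φ D →
              (∀ x, ∫⁻ s, ‖gradient φ x - stochGrad Φ x s‖ₑ ^ 2 ∂D ≤ ENNReal.ofReal (σ ^ 2)) →
              ‖x₀ - ηstar‖ ≤ R →
              IsRandomASBCDS P ℱ D Φ γ τ K M J i ξ x₀ lam zeta eta w →
              Integrable (fun ω => φ (eta K ω)) P ∧
                ∫ ω, φ (eta K ω) ∂P - φ ηstar ≤ ε) := by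
  -- The constant comes from `exists_batch_complexity`; it exceeds `rateConst c`, so it also serves
  -- (i).
  refine ⟨8 * (rateConst c + 2) ^ 2, ?_, ?_, ?_⟩
  · have : 0 ≤ rateConst c := Real.sqrt_nonneg _
    positivity
  · intro m n τ K M L γ ε Ω Ξ mΩ _ P _ ℱ D _ φ Φ J i ξ x₀ u lam zeta eta w hτ hτm hL hγ hε hM hcs hs
      hconv hφ hu hΦ h hnoise hK
    refine h.integral_sub_le_eps hc hτ hτm hL hγ hε hM hcs hs hconv hφ hu hΦ
      (fun k hk => hnoise (k + 1) (Finset.mem_Icc.2 ⟨by omega, hk⟩)) (le_trans ?_ hK)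
    have hC : 0 ≤ rateConst c := Real.sqrt_nonneg _
    refine mul_le_mul_of_nonneg_right ?_ (by positivity)
    nlinarith
  · intro m τ L γ ε σ R hτ hτm hL hγ hε _ hR hcs hs
    have hm : 1 ≤ m := hτ.trans hτm
    have hC : 0 ≤ rateConst c := Real.sqrt_nonneg _
    -- Here the starting point is already `ε`-optimal by the descent lemma, and `K = 0` avoids a
    -- rounding cost that the bound could not cover.
    by_cases hLR : L * R ^ 2 ≤ 2 * ε
    · refine ⟨0, fun _ => 1, fun _ => le_rfl, monotone_const, ?_, ?_, ?_⟩
      · rw [Nat.cast_zero]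
        positivity
      · simp only [oracleCalls, Finset.Icc_eq_empty_of_lt zero_lt_one, Finset.sum_empty,
          Nat.cast_zero]
        positivity
      · intro n Ω Ξ mΩ _ P _ ℱ D _ φ Φ J i ξ x₀ u lam zeta eta w hconv hφ hu hΦ _ hx h
        have e : ∀ ω, eta 0 ω = x₀ := fun ω => (h.run ω).eta_zero
        have h1 := le_add_inner_gradient_add hφ.1 hφ.2 u x₀
        rw [hu.gradient_eq_zero, inner_zero_left] at h1
        have h2 : L / 2 * ‖x₀ - u‖ ^ 2 ≤ L / 2 * R ^ 2 := by gcongr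
        simp only [e, integrable_const, integral_const, probReal_univ, one_smul, true_and]
        linarith
    · obtain ⟨K, hK1, hK2, hK3⟩ :=
        exists_batch_complexity hτ hτm hL hε hR σ (rateConst c) hC (not_le.1 hLR)
      refine ⟨K, batchSize m L ε σ, fun k => Nat.le_add_left 1 _,
        monotone_batchSize hm hL hε σ, hK2, hK3, ?_⟩
      intro n Ω Ξ mΩ _ P _ ℱ D _ φ Φ J i ξ x₀ u lam zeta eta w hconv hφ hu hΦ hσ hx h
      refine h.integral_sub_le_eps hc hτ hτm hL hγ hε (fun k => Nat.le_add_left 1 _) hcs hs hconv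
        hφ hu hΦ (fun k hk => ?_) (le_trans ?_ hK1)
      · exact (h.lintegral_noise_le hm (fun k => Nat.le_add_left 1 _) hφ hΦ hσ hk).trans
          (ENNReal.ofReal_le_ofReal (sq_div_batchSize_le hm hL hε σ (k + 1)))
      · gcongr
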